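/- Let $(A,\mathfrak m)$ be a Noetherian local ring of Krull dimension $1$ that is a hypersurface (its $\mathfrak m$-adic completion is isomorphic to $S/(f)$ with $S$ a regular local ring and $0\neq f$ in the maximal ideal of $S$; this includes all rings $A=S/(f)$ themselves) with isolated singularity ($A_{\mathfrak p}$ is regular for every prime $\mathfrak p\neq\mathfrak m$). Then for all finitely generated $A$-modules $M,N$ the length $\ell(\operatorname{Tor}_i^A(M,N))$ is finite for $i>\dim A$, and Hochster's theta invariant $$\theta^A(M,N)=\ell(\operatorname{Tor}^A_{2e+2}(M,N))-\ell(\operatorname{Tor}^A_{2e+1}(M,N)),\qquad 2e\ge\dim A,$$ does not depend on the choice of $e$. For every finitely generated $A$-module $M$ one has $$\theta^A(M,M)\le 0,$$ with equality if and only if the ranks $\dim_{A_{\mathfrak p}}M_{\mathfrak p}$ coincide for all minimal primes $\mathfrak p$ of $A$. Moreover, $\theta^A$ induces a symmetric negative semidefinite $\mathbb Q$-bilinear form on the rational reduced Grothendieck group $\underline{G_0}(A)_{\mathbb Q}=(G_0(A)/\mathbb Z[A])\otimes_{\mathbb Z}\mathbb Q$, where $G_0(A)$ is the Grothendieck group of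 finitely generated $A$-modules. -/

import Mathlib

universe u

noncomputable section

/-- A Noetherian local ring is a (local) hypersurface if its completion is the quotient of a
regular local ring by a nonzero element of the maximal ideal. Every ring of the form `S ⧸ (f)`
with `S` regular local and `0 ≠ f ∈ 𝔪_S` is one, since its completion is `Ŝ ⧸ (f)`. -/
def IsLocalHypersurface (A : Type u) [CommRing A] [IsLocalRing A] : Prop :=
  IsNoetherianRing A ∧
    ∃ (S : Type u) (_ : CommRing S) (_ : IsRegularLocalRing S) (f : S),
      f ≠ 0 ∧ f ∈ IsLocalRing.maximalIdeal S ∧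
        Nonempty (AdicCompletion (IsLocalRing.maximalIdeal A) A ≃+* S ⧸ Ideal.span {f})

/-- `A_𝔭` is regular for every non-maximal prime `𝔭` of the local ring `A`. -/
def HasIsolatedSingularity (A : Type u) [CommRing A] [IsLocalRing A] : Prop :=
  ∀ (p : Ideal A) [p.IsPrime], p ≠ IsLocalRing.maximalIdeal A →
    IsRegularLocalRing (Localization.AtPrime p)

/-- `Tor_i^A(M, N)`. -/
abbrev torModule (A : Type u) [CommRing A] (i : ℕ)
    (M : Type u) [AddCommGroup M] [Module A M] (N : Type u) [AddCommGroup N] [Module A N] :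
    ModuleCat.{u} A :=
  ((CategoryTheory.Tor (ModuleCat.{u} A) i).obj (ModuleCat.of A M)).obj (ModuleCat.of A N)

/-- `ℓ(Tor_{2e+2}^A(M, N)) - ℓ(Tor_{2e+1}^A(M, N))`, which is Hochster's `θ^A(M, N)` for any
`e` with `2e ≥ dim A`. (Meaningful when both lengths are finite.) -/
def hochsterTheta (A : Type u) [CommRing A] (e : ℕ)
    (M : Type u) [AddCommGroup M] [Module A M] (N : Type u) [AddCommGroup N] [Module A N] : ℤ :=
  ((Module.length A (torModule A (2 * e + 2) M N)).toNat : ℤ) -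
    ((Module.length A (torModule A (2 * e + 1) M N)).toNat : ℤ)

/-- The relations `[M] = [M'] + [M'']` for all short exact sequences `0 → M' → M → M'' → 0` of
finitely generated modules. -/
def G0Relations (A : Type u) [CommRing A] :
    AddSubgroup (FreeAbelianGroup (FGModuleCat.{u} A)) :=
  AddSubgroup.closure
    {x | ∃ (M' M M'' : FGModuleCat.{u} A) (f : M' →ₗ[A] M) (g : M →ₗ[A] M''),
      Function.Injective f ∧ Function.Exact f g ∧ Function.Surjective g ∧
        x = FreeAbelianGroup.of M - FreeAbelianGroup.of M' - FreeAbelianGroup.of M''}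

/-- The Grothendieck group of finitely generated `A`-modules. -/
abbrev G0 (A : Type u) [CommRing A] : Type (u + 1) :=
  FreeAbelianGroup (FGModuleCat.{u} A) ⧸ G0Relations A

/-- The class `[M]` in `G₀(A)`. -/
def G0.cls (A : Type u) [CommRing A]
    (M : Type u) [AddCommGroup M] [Module A M] [Module.Finite A M] : G0 A :=
  QuotientAddGroup.mk (FreeAbelianGroup.of (FGModuleCat.of A M))

/-- The reduced Grothendieck group `G₀(A) / ℤ[A]`. -/
abbrev ReducedG0 (A : Type u) [CommRing A] : Type (u + 1) :=
  G0 A ⧸ AddSubgroup.zmultiples (G0.cls A A)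

/-- The reduced Grothendieck group with rational coefficients. -/
abbrev RationalReducedG0 (A : Type u) [CommRing A] : Type (u + 1) :=
  TensorProduct ℤ ℚ (ReducedG0 A)

/-- The class of `M` in the reduced Grothendieck group with rational coefficients. -/
def RationalReducedG0.cls (A : Type u) [CommRing A]
    (M : Type u) [AddCommGroup M] [Module A M] [Module.Finite A M] : RationalReducedG0 A :=
  TensorProduct.tmul ℤ (1 : ℚ) (QuotientAddGroup.mk (G0.cls A M) : ReducedG0 A)

/-- `M` has the same rank `dim_{A_𝔭} M_𝔭` at all minimal primes `𝔭` of `A`. -/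
def HasConstantMinimalRank (A : Type u) [CommRing A]
    (M : Type u) [AddCommGroup M] [Module A M] : Prop :=
  ∀ p q : PrimeSpectrum A, p.asIdeal ∈ minimalPrimes A → q.asIdeal ∈ minimalPrimes A →
    Module.rankAtStalk M p = Module.rankAtStalk M q

end

/-!
Over the completion of a hypersurface, high syzygies are given by matrix factorizations and hence
have 2-periodic resolutions; the periodicity descends to the ring `A` itself. Every other term in
the sequence of lengths of the images of the connecting maps in a long exact `Tor` sequence then
forms an arithmetic progression which is bounded, hence constant, so `θ` is additive in each
variable. For a regular element `x`, additivity along a composition series of `A/(x)` turns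
`θ(A/(x), N) = 0` into `θ(k, N) = 0`, and dévissage gives
`θ(M, N) = ∑ rank_𝔭 M * rank_𝔮 N * θ(A/𝔭, A/𝔮)` over the minimal primes. The rows of the matrix
`θ(A/𝔭, A/𝔮)` sum to `θ(A, A/𝔮) = 0`. Each minimal prime is principal, say `𝔭 = (a)`, and for
`𝔮 ≠ 𝔭` the element `a` is regular on `A/𝔮`, so `Tor_1(A/𝔭, A/𝔮) = 0` while `Tor_2 ≠ 0`: the
off-diagonal entries are positive. Hence `-2 * θ` is a weighted graph Laplacian evaluated at the
ranks.
-/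

section Tor

open CategoryTheory MonoidalCategory TensorProduct

variable {A : Type u} [CommRing A]

theorem exact_conj_linearEquiv {X Y Z X' Y' Z' : Type*} [AddCommGroup X] [AddCommGroup Y]
    [AddCommGroup Z] [AddCommGroup X'] [AddCommGroup Y'] [AddCommGroup Z'] [Module A X] [Module A Y]
    [Module A Z] [Module A X'] [Module A Y'] [Module A Z'] (e₁ : X' ≃ₗ[A] X) (e₂ : Y' ≃ₗ[A] Y)
    (e₃ : Z' ≃ₗ[A] Z) {f : X →ₗ[A] Y} {g : Y →ₗ[A] Z} (h : Function.Exact f g) :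
    Function.Exact (e₂.symm.toLinearMap ∘ₗ f ∘ₗ e₁.toLinearMap)
      (e₃.symm.toLinearMap ∘ₗ g ∘ₗ e₂.toLinearMap) :=
  Function.Exact.of_ladder_linearEquiv_of_exact (e₁ := e₁.symm) (e₂ := e₂.symm) (e₃ := e₃.symm)
    (by ext; simp) (by ext; simp) h

section LongExactSequence

variable {M' M M'' : Type u} [AddCommGroup M'] [Module A M'] [AddCommGroup M] [Module A M]
  [AddCommGroup M''] [Module A M'']

/-- Tensoring a complex `C` with a linear map `f : M → M'` on the left. -/
noncomputable abbrev tensorComplexMap (f : M →ₗ[A] M') (C : ChainComplex (ModuleCat.{u} A) ℕ) :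
    ((tensorLeft (ModuleCat.of A M)).mapHomologicalComplex _).obj C ⟶
      ((tensorLeft (ModuleCat.of A M')).mapHomologicalComplex _).obj C :=
  (NatTrans.mapHomologicalComplex ((curriedTensor (ModuleCat.{u} A)).map (ModuleCat.ofHom f))
    (ComplexShape.down ℕ)).app C

theorem tensorComplexMap_comp_eq_zero {f : M' →ₗ[A] M} {g : M →ₗ[A] M''}
    (hfg : Function.Exact f g) (C : ChainComplex (ModuleCat.{u} A) ℕ) :
    tensorComplexMap f C ≫ tensorComplexMap g C = 0 := by
  ext i : 1
  apply ModuleCat.hom_ext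
  refine TensorProduct.ext' fun x y => ?_
  change g (f x) ⊗ₜ[A] y = 0
  rw [hfg.apply_apply_eq_zero, TensorProduct.zero_tmul]

theorem shortExact_tensorComplexMap {f : M' →ₗ[A] M} {g : M →ₗ[A] M''}
    (hf : Function.Injective f) (hfg : Function.Exact f g) (hg : Function.Surjective g)
    (C : ChainComplex (ModuleCat.{u} A) ℕ) [∀ i, Module.Flat A (C.X i)] :
    (ShortComplex.mk _ _ (tensorComplexMap_comp_eq_zero hfg C)).ShortExact := by
  refine HomologicalComplex.shortExact_of_degreewise_shortExact _ fun i =>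
    ShortComplex.ShortExact.mk' ?_ ?_ ?_
  · rw [ShortComplex.ShortExact.moduleCat_exact_iff_function_exact]
    exact rTensor_exact (C.X i) hfg hg
  · rw [ModuleCat.mono_iff_injective]
    exact Module.Flat.rTensor_preserves_injective_linearMap (M := C.X i) f hf
  · rw [ModuleCat.epi_iff_surjective]
    exact LinearMap.rTensor_surjective (C.X i) hg

theorem exists_tor_longExact {f : M' →ₗ[A] M} {g : M →ₗ[A] M''}
    (hf : Function.Injective f) (hfg : Function.Exact f g) (hg : Function.Surjective g)
    (N : Type u) [AddCommGroup N] [Module A N] :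
    ∃ (α : ∀ i, torModule A i M' N →ₗ[A] torModule A i M N)
      (β : ∀ i, torModule A i M N →ₗ[A] torModule A i M'' N)
      (δ : ∀ i, torModule A (i + 1) M'' N →ₗ[A] torModule A i M' N),
      ∀ i, Function.Exact (α i) (β i) ∧ Function.Exact (β (i + 1)) (δ i) ∧
        Function.Exact (δ i) (α i) := by
  let P := projectiveResolution (ModuleCat.of A N)
  have (i : ℕ) : Module.Projective A (P.complex.X i) :=
    (IsProjective.iff_projective (P.complex.X i)).mpr (P.projective i)
  have hS := shortExact_tensorComplexMap hf hfg hg P.complex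
  let e (X : Type u) [AddCommGroup X] [Module A X] (i : ℕ) :=
    (P.isoLeftDerivedObj (tensorLeft (ModuleCat.of A X)) i).toLinearEquiv
  have conj {X Y Z : ModuleCat.{u} A} {a : X ⟶ Y} {b : Y ⟶ Z} {w : a ≫ b = 0}
      (h : (ShortComplex.mk a b w).Exact) : Function.Exact a.hom b.hom :=
    (ShortComplex.ShortExact.moduleCat_exact_iff_function_exact _).mp h
  refine ⟨fun i => (e M i).symm.toLinearMap ∘ₗ
      (HomologicalComplex.homologyMap (tensorComplexMap f P.complex) i).hom ∘ₗ
        (e M' i).toLinearMap,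
    fun i => (e M'' i).symm.toLinearMap ∘ₗ
      (HomologicalComplex.homologyMap (tensorComplexMap g P.complex) i).hom ∘ₗ
        (e M i).toLinearMap,
    fun i => (e M' i).symm.toLinearMap ∘ₗ
      (hS.δ (i + 1) i rfl).hom ∘ₗ (e M'' (i + 1)).toLinearMap, fun i => ⟨?_, ?_, ?_⟩⟩
  · exact exact_conj_linearEquiv _ _ _ (conj (hS.homology_exact₂ i))
  · exact exact_conj_linearEquiv _ _ _ (conj (hS.homology_exact₃ (i + 1) i rfl))
  · exact exact_conj_linearEquiv _ _ _ (conj (hS.homology_exact₁ (i + 1) i rfl))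

end LongExactSequence

theorem nonempty_ker_quotient_range_equiv_ker {X Y W V : Type*} [AddCommGroup X]
    [AddCommGroup Y] [AddCommGroup W] [AddCommGroup V] [Module A X] [Module A Y] [Module A W]
    [Module A V] {f : X →ₗ[A] Y} {π : Y →ₗ[A] W} {ι : W →ₗ[A] V} {g : Y →ₗ[A] V}
    (h : Function.Exact f π) (hπ : Function.Surjective π) (hg : ι ∘ₗ π = g)
    (f' : X →ₗ[A] LinearMap.ker g) (hf' : ∀ x, (f' x : Y) = f x) :
    Nonempty ((LinearMap.ker g ⧸ LinearMap.range f') ≃ₗ[A] LinearMap.ker ι) := by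
  subst hg
  let ρ : LinearMap.ker (ι ∘ₗ π) →ₗ[A] LinearMap.ker ι :=
    (π ∘ₗ (LinearMap.ker (ι ∘ₗ π)).subtype).codRestrict _ fun x => x.2
  have hρ : LinearMap.ker ρ = LinearMap.range f' := by
    ext x
    simp only [LinearMap.mem_ker, LinearMap.mem_range]
    refine Subtype.ext_iff.trans ((h x).trans (exists_congr fun y => ?_))
    rw [Subtype.ext_iff, hf']
  refine ⟨(Submodule.quotEquivOfEq _ _ hρ.symm).trans (ρ.quotKerEquivOfSurjective ?_)⟩
  rintro ⟨w, hw⟩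
  obtain ⟨y, rfl⟩ := hπ w
  exact ⟨⟨y, hw⟩, rfl⟩

section Syzygy

variable (A) (N : Type u) [AddCommGroup N] [Module A N]

/-- The `i`-th term of the projective resolution of `N` used to compute `Tor`. -/
noncomputable abbrev resolutionTerm (i : ℕ) : ModuleCat.{u} A :=
  (projectiveResolution (ModuleCat.of A N)).complex.X i

/-- The `i`-th differential of the projective resolution of `N` used to compute `Tor`. -/
noncomputable def resolutionDifferential (i : ℕ) :
    resolutionTerm A N (i + 1) →ₗ[A] resolutionTerm A N i :=
  ((projectiveResolution (ModuleCat.of A N)).complex.d (i + 1) i).hom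

/-- The image of the `i`-th differential in the projective resolution of `N`; with this indexing
`syzygy A N 0` is the kernel of the augmentation. -/
noncomputable abbrev syzygy (i : ℕ) : Submodule A (resolutionTerm A N i) :=
  LinearMap.range (resolutionDifferential A N i)

/-- The augmentation of the projective resolution of `N`. -/
noncomputable def resolutionAugmentation : resolutionTerm A N 0 →ₗ[A] N :=
  ((projectiveResolution (ModuleCat.of A N)).π.f 0).hom

/-- The map `P (i + 1) → syzygy A N i` induced by the differential. -/
noncomputable abbrev syzygyCover (i : ℕ) :
    resolutionTerm A N (i + 1) →ₗ[A] syzygy A N i :=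
  (resolutionDifferential A N i).rangeRestrict

instance (i : ℕ) : Module.Projective A (resolutionTerm A N i) :=
  (IsProjective.iff_projective (resolutionTerm A N i)).mpr
    ((projectiveResolution (ModuleCat.of A N)).projective i)

theorem resolutionAugmentation_surjective :
    Function.Surjective (resolutionAugmentation A N) :=
  (ModuleCat.epi_iff_surjective ((projectiveResolution (ModuleCat.of A N)).π.f 0)).mp inferInstance

theorem syzygyCover_surjective (i : ℕ) : Function.Surjective (syzygyCover A N i) :=
  LinearMap.surjective_rangeRestrict _

theorem exact_resolutionDifferential (i : ℕ) :
    Function.Exact (resolutionDifferential A N (i + 1)) (resolutionDifferential A N i) :=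
  (ShortComplex.ShortExact.moduleCat_exact_iff_function_exact _).mp
    ((projectiveResolution (ModuleCat.of A N)).exact_succ i)

theorem exact_syzygy_zero_augmentation :
    Function.Exact (syzygy A N 0).subtype (resolutionAugmentation A N) := by
  rw [LinearMap.exact_iff, Submodule.range_subtype]
  exact LinearMap.exact_iff.mp ((ShortComplex.ShortExact.moduleCat_exact_iff_function_exact _).mp
    (projectiveResolution (ModuleCat.of A N)).exact₀)

theorem exact_syzygy_succ_cover (i : ℕ) :
    Function.Exact (syzygy A N (i + 1)).subtype (syzygyCover A N i) := by
  rw [LinearMap.exact_iff, Submodule.range_subtype, syzygyCover, LinearMap.ker_rangeRestrict]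
  exact LinearMap.exact_iff.mp (exact_resolutionDifferential A N i)

theorem nonempty_tor_succ_equiv_ker_lTensor_syzygy (M : Type u) [AddCommGroup M] [Module A M]
    (i : ℕ) :
    Nonempty (torModule A (i + 1) M N ≃ₗ[A]
      LinearMap.ker ((syzygy A N i).subtype.lTensor M)) := by
  let F := tensorLeft (ModuleCat.of A M)
  let C := (F.mapHomologicalComplex (ComplexShape.down ℕ)).obj
    (projectiveResolution (ModuleCat.of A N)).complex
  let homologyIso := (projectiveResolution (ModuleCat.of A N)).isoLeftDerivedObj F (i + 1) ≪≫
    ShortComplex.homologyMapIso (C.isoSc' (i + 2) (i + 1) i (by simp) (by simp)) ≪≫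
    (C.sc' (i + 2) (i + 1) i).moduleCatHomologyIso
  have hfac : (syzygy A N i).subtype.lTensor M ∘ₗ (syzygyCover A N i).lTensor M =
      (resolutionDifferential A N i).lTensor M :=
    (LinearMap.lTensor_comp _ _ _).symm
  have hex : Function.Exact ((resolutionDifferential A N (i + 1)).lTensor M)
      ((syzygyCover A N i).lTensor M) := by
    refine lTensor_exact M ?_ (syzygyCover_surjective A N i)
    rw [LinearMap.exact_iff, syzygyCover, LinearMap.ker_rangeRestrict]
    exact LinearMap.exact_iff.mp (exact_resolutionDifferential A N i)
  obtain ⟨e⟩ := nonempty_ker_quotient_range_equiv_ker hex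
    (LinearMap.lTensor_surjective M (syzygyCover_surjective A N i)) hfac
    (C.sc' (i + 2) (i + 1) i).moduleCatToCycles (fun _ => rfl)
  exact ⟨homologyIso.toLinearEquiv ≪≫ₗ e⟩

end Syzygy

section

variable {M N K F : Type u} [AddCommGroup M] [Module A M] [AddCommGroup N] [Module A N]
  [AddCommGroup K] [Module A K] [AddCommGroup F] [Module A F]

theorem subsingleton_tor_of_flat [Module.Flat A F] (i : ℕ) (N : Type u) [AddCommGroup N]
    [Module A N] : Subsingleton (torModule A (i + 1) F N) := by
  obtain ⟨e⟩ := nonempty_tor_succ_equiv_ker_lTensor_syzygy A N F i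
  have : LinearMap.ker ((syzygy A N i).subtype.lTensor F) = ⊥ := LinearMap.ker_eq_bot.mpr
    (Module.Flat.lTensor_preserves_injective_linearMap _ Subtype.val_injective)
  rw [this] at e
  exact e.toEquiv.subsingleton

theorem smul_tor_eq_zero {r : A} (hr : ∀ m : M, r • m = 0) (i : ℕ) (N : Type u) [AddCommGroup N]
    [Module A N] (x : torModule A (i + 1) M N) : r • x = 0 := by
  obtain ⟨e⟩ := nonempty_tor_succ_equiv_ker_lTensor_syzygy A N M i
  have smul_tensor (y : M ⊗[A] syzygy A N i) : r • y = 0 := by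
    induction y with
    | zero => exact smul_zero r
    | add y z hy hz => rw [smul_add, hy, hz, add_zero]
    | tmul m z => rw [TensorProduct.smul_tmul', hr, TensorProduct.zero_tmul]
  rw [← e.map_eq_zero_iff, map_smul]
  exact Subtype.ext (smul_tensor _)

theorem nonempty_tor_equiv_of_equiv {M' : Type u} [AddCommGroup M'] [Module A M']
    (e : M ≃ₗ[A] M') (i : ℕ) (N : Type u) [AddCommGroup N] [Module A N] :
    Nonempty (torModule A i M N ≃ₗ[A] torModule A i M' N) :=
  ⟨(((Tor (ModuleCat.{u} A) i).mapIso e.toModuleIso).app (ModuleCat.of A N)).toLinearEquiv⟩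

theorem nonempty_tor_succ_equiv [Module.Flat A F] {k : K →ₗ[A] F} {p : F →ₗ[A] M}
    (hk : Function.Injective k) (hkp : Function.Exact k p) (hp : Function.Surjective p) (i : ℕ)
    (N : Type u) [AddCommGroup N] [Module A N] :
    Nonempty (torModule A (i + 2) M N ≃ₗ[A] torModule A (i + 1) K N) := by
  obtain ⟨α, β, δ, h⟩ := exists_tor_longExact hk hkp hp N
  have := subsingleton_tor_of_flat (A := A) (F := F) i N
  have := subsingleton_tor_of_flat (A := A) (F := F) (i + 1) N
  refine ⟨LinearEquiv.ofBijective (δ (i + 1)) ⟨?_, fun y => ?_⟩⟩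
  · refine (injective_iff_map_eq_zero _).mpr fun x hx => ?_
    obtain ⟨y, rfl⟩ := ((h (i + 1)).2.1 x).mp hx
    rw [Subsingleton.elim y 0, map_zero]
  · exact ((h (i + 1)).2.2 y).mp (Subsingleton.elim _ _)

theorem nonempty_ker_lTensor_equiv_ker_rTensor {Z P : Type*} [AddCommGroup Z] [Module A Z]
    [AddCommGroup P] [Module A P] [Module.Flat A F] [Module.Flat A P]
    {k : K →ₗ[A] F} {p : F →ₗ[A] M}
    (hk : Function.Injective k) (hkp : Function.Exact k p) (hp : Function.Surjective p)
    {ι : Z →ₗ[A] P} {ε : P →ₗ[A] N}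
    (hι : Function.Injective ι) (hιε : Function.Exact ι ε) (hε : Function.Surjective ε) :
    Nonempty (LinearMap.ker (ι.lTensor M) ≃ₗ[A] LinearMap.ker (k.rTensor N)) := by
  have hker₂ : Function.Exact (0 : Unit →ₗ[A] F ⊗[A] Z) (ι.lTensor F) :=
    (LinearMap.exact_zero_iff_injective Unit _).mpr
      (Module.Flat.lTensor_preserves_injective_linearMap (M := F) ι hι)
  have hker₃ : Function.Exact (LinearMap.ker (ι.lTensor M)).subtype (ι.lTensor M) :=
    LinearMap.exact_subtype_ker_map _
  have comm_sq (X Y : Type u) [AddCommGroup X] [Module A X] [AddCommGroup Y] [Module A Y]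
      (f : X →ₗ[A] Y) : (f.rTensor P).comp (ι.lTensor X) = (ι.lTensor Y).comp (f.rTensor Z) := by
    ext; simp
  have hrowZ := rTensor_exact Z hkp hp
  have hrowP := rTensor_exact P hkp hp
  have hpZ := LinearMap.rTensor_surjective Z hp
  have hkP := Module.Flat.rTensor_preserves_injective_linearMap (M := P) k hk
  have hcolK := lTensor_exact K hιε hε
  have hcolF := lTensor_exact F hιε hε
  let δ := SnakeLemma.δ' (ι.lTensor K) (ι.lTensor F) (ι.lTensor M) (k.rTensor Z) (p.rTensor Z)
    hrowZ (k.rTensor P) (p.rTensor P) hrowP (comm_sq _ _ k) (comm_sq _ _ p) _ hker₃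
    (ε.lTensor K) hcolK hpZ hkP
  have hδ_right : Function.Exact (0 : Unit →ₗ[A] LinearMap.ker (ι.lTensor M)) δ :=
    SnakeLemma.exact_δ'_right (ι.lTensor K) (ι.lTensor F) (ι.lTensor M) (k.rTensor Z)
      (p.rTensor Z) hrowZ (k.rTensor P) (p.rTensor P) hrowP (comm_sq _ _ k) (comm_sq _ _ p) 0
      hker₂ _ hker₃ (ε.lTensor K) hcolK hpZ hkP 0 (by simp) Subtype.val_injective
  have hδ_left : Function.Exact δ (k.rTensor N) :=
    SnakeLemma.exact_δ'_left (ι.lTensor K) (ι.lTensor F) (ι.lTensor M) (k.rTensor Z)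
      (p.rTensor Z) hrowZ (k.rTensor P) (p.rTensor P) hrowP (comm_sq _ _ k) (comm_sq _ _ p) _
      hker₃ (ε.lTensor K) hcolK (ε.lTensor F) hcolF hpZ hkP (k.rTensor N) (by ext; simp)
      (LinearMap.lTensor_surjective K hε)
  have hδ_injective := (LinearMap.exact_zero_iff_injective Unit δ).mp hδ_right
  exact ⟨(LinearEquiv.ofInjective δ hδ_injective).trans
    (LinearEquiv.ofEq _ _ hδ_left.linearMap_ker_eq.symm)⟩

theorem nonempty_tor_one_equiv_ker_rTensor [Module.Flat A F] {k : K →ₗ[A] F} {p : F →ₗ[A] M}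
    (hk : Function.Injective k) (hkp : Function.Exact k p) (hp : Function.Surjective p)
    (N : Type u) [AddCommGroup N] [Module A N] :
    Nonempty (torModule A 1 M N ≃ₗ[A] LinearMap.ker (k.rTensor N)) := by
  obtain ⟨e⟩ := nonempty_tor_succ_equiv_ker_lTensor_syzygy A N M 0
  obtain ⟨e'⟩ := nonempty_ker_lTensor_equiv_ker_rTensor hk hkp hp Subtype.val_injective
    (exact_syzygy_zero_augmentation A N) (resolutionAugmentation_surjective A N)
  exact ⟨e.trans e'⟩

variable (A) in
theorem nonempty_tor_add_equiv_tor_syzygy (N M : Type u) [AddCommGroup N] [Module A N]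
    [AddCommGroup M] [Module A M] (i j : ℕ) :
    Nonempty (torModule A (i + j + 2) N M ≃ₗ[A]
      torModule A (j + 1) (syzygy A N i) M) := by
  induction i generalizing j with
  | zero =>
    rw [zero_add]
    exact nonempty_tor_succ_equiv Subtype.val_injective (exact_syzygy_zero_augmentation A N)
      (resolutionAugmentation_surjective A N) j M
  | succ i ih =>
    obtain ⟨e⟩ := ih (j + 1)
    obtain ⟨e'⟩ := nonempty_tor_succ_equiv Subtype.val_injective (exact_syzygy_succ_cover A N i)
      (syzygyCover_surjective A N i) j M
    rw [Nat.add_right_comm i 1 j]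
    exact ⟨e.trans e'⟩

variable (A) in
theorem nonempty_tor_succ_equiv_ker_rTensor_syzygy (N M : Type u) [AddCommGroup N] [Module A N]
    [AddCommGroup M] [Module A M] (i : ℕ) :
    Nonempty (torModule A (i + 1) N M ≃ₗ[A]
      LinearMap.ker ((syzygy A N i).subtype.rTensor M)) := by
  cases i with
  | zero =>
    exact nonempty_tor_one_equiv_ker_rTensor Subtype.val_injective
      (exact_syzygy_zero_augmentation A N) (resolutionAugmentation_surjective A N) M
  | succ i =>
    obtain ⟨e⟩ := nonempty_tor_add_equiv_tor_syzygy A N M i 0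
    obtain ⟨e'⟩ := nonempty_tor_one_equiv_ker_rTensor Subtype.val_injective
      (exact_syzygy_succ_cover A N i) (syzygyCover_surjective A N i) M
    exact ⟨e.trans e'⟩

theorem nonempty_tor_comm (M N : Type u) [AddCommGroup M] [Module A M] [AddCommGroup N]
    [Module A N] (i : ℕ) :
    Nonempty (torModule A (i + 1) M N ≃ₗ[A] torModule A (i + 1) N M) := by
  obtain ⟨e⟩ := nonempty_tor_succ_equiv_ker_lTensor_syzygy A N M i
  obtain ⟨e'⟩ := nonempty_tor_succ_equiv_ker_rTensor_syzygy A N M i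
  let ι := (syzygy A N i).subtype
  have hmap : (LinearMap.ker (ι.lTensor M)).map (TensorProduct.comm A M _).toLinearMap =
      LinearMap.ker (ι.rTensor M) := by
    ext x
    rw [Submodule.mem_map_equiv, LinearMap.mem_ker, LinearMap.mem_ker,
      ← LinearMap.comm_comp_rTensor_comp_comm_eq]
    simp
  exact ⟨e.trans (((TensorProduct.comm A M _).submoduleMap _).trans
    ((LinearEquiv.ofEq _ _ hmap).trans e'.symm))⟩

theorem finite_tor [IsNoetherianRing A] (i : ℕ) (M N : Type u) [AddCommGroup M] [Module A M]
    [Module.Finite A M] [AddCommGroup N] [Module A N] [Module.Finite A N] :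
    Module.Finite A (torModule A (i + 1) M N) := by
  induction i generalizing M with
  | zero =>
    obtain ⟨n, p, hp⟩ := Module.Finite.exists_fin' A M
    obtain ⟨e⟩ := nonempty_tor_one_equiv_ker_rTensor Subtype.val_injective
      (LinearMap.exact_subtype_ker_map p) hp N
    have : IsNoetherian A (LinearMap.ker p ⊗[A] N) :=
      isNoetherian_of_isNoetherianRing_of_finite A (LinearMap.ker p ⊗[A] N)
    exact Module.Finite.equiv e.symm
  | succ i ih =>
    obtain ⟨n, p, hp⟩ := Module.Finite.exists_fin' A M
    obtain ⟨e⟩ := nonempty_tor_succ_equiv Subtype.val_injective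
      (LinearMap.exact_subtype_ker_map p) hp i N
    have := ih (LinearMap.ker p)
    exact Module.Finite.equiv e.symm

end

end Tor

section RegularLocalRing

open IsLocalRing Pointwise

section NoetherianLocal

variable {R : Type*} [CommRing R] [IsLocalRing R] [IsNoetherianRing R]

theorem exists_mem_maximalIdeal_notMem_sq_notMem_minimalPrimes
    (hR : 0 < (maximalIdeal R).height) :
    ∃ u ∈ maximalIdeal R, u ∉ maximalIdeal R ^ 2 ∧ ∀ q ∈ minimalPrimes R, u ∉ q := by
  by_contra! h
  have hfinite : (insert (maximalIdeal R ^ 2) (minimalPrimes R)).Finite :=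
    (minimalPrimes.finite_of_isNoetherianRing R).insert _
  have hcover : (maximalIdeal R : Set R) ⊆
      ⋃ I ∈ insert (maximalIdeal R ^ 2) (minimalPrimes R), (I : Set R) := fun x hx => by
    by_cases hx2 : x ∈ maximalIdeal R ^ 2
    · exact Set.mem_biUnion (Set.mem_insert _ _) hx2
    · obtain ⟨q, hq, hxq⟩ := h x hx hx2
      exact Set.mem_biUnion (Set.mem_insert_of_mem _ hq) hxq
  obtain ⟨I, hI, hle⟩ := (Ideal.subset_union_prime_finite hfinite (f := id)
    (maximalIdeal R ^ 2) (maximalIdeal R ^ 2) fun I hI hne _ =>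
      (hI.resolve_left hne).1.1).mp hcover
  suffices maximalIdeal R ∈ minimalPrimes R from
    hR.ne' (Ideal.height_eq_zero_iff.mpr this)
  rcases hI with rfl | hI
  · have hbot : maximalIdeal R = ⊥ := Submodule.eq_bot_of_le_smul_of_le_jacobson_bot
      (maximalIdeal R) _ (maximalIdeal R).fg_of_isNoetherianRing
      (by simpa [pow_two] using hle) (maximalIdeal_le_jacobson _)
    exact ⟨⟨inferInstance, bot_le⟩, fun q _ _ => hbot ▸ bot_le⟩
  · rwa [← le_antisymm (le_maximalIdeal hI.1.1.ne_top) hle]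

theorem isDomain_of_isPrime_span_singleton {u : R} (hu : u ∈ maximalIdeal R)
    (hprime : (Ideal.span {u}).IsPrime) (hmin : ∀ q ∈ minimalPrimes R, u ∉ q) : IsDomain R := by
  obtain ⟨q, hq, hqu⟩ := Ideal.exists_minimalPrimes_le (I := ⊥) (J := Ideal.span {u}) bot_le
  have hq_prime : q.IsPrime := hq.1.1
  have hq_le : q ≤ maximalIdeal R • q := fun x hx => by
    obtain ⟨y, rfl⟩ := Ideal.mem_span_singleton'.mp (hqu hx)
    rw [mul_comm]
    exact Submodule.smul_mem_smul hu ((hq_prime.mem_or_mem hx).resolve_right (hmin q hq))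
  have hq_bot : q = ⊥ := Submodule.eq_bot_of_le_smul_of_le_jacobson_bot (maximalIdeal R) _
    q.fg_of_isNoetherianRing hq_le (maximalIdeal_le_jacobson _)
  subst hq_bot
  exact IsDomain.of_bot_isPrime R

theorem isLocalRing_quotient_of_le_maximalIdeal {R : Type*} [CommRing R] [IsLocalRing R]
    {I : Ideal R} (hI : I ≤ maximalIdeal R) : IsLocalRing (R ⧸ I) :=
  have : Nontrivial (R ⧸ I) := Ideal.Quotient.nontrivial_iff.mpr fun h =>
    (maximalIdeal.isMaximal R).ne_top (top_le_iff.mp (h ▸ hI))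
  IsLocalRing.of_surjective' _ Ideal.Quotient.mk_surjective

open scoped Classical in
theorem exists_maximalIdeal_eq_span_insert_erase {R : Type*} [CommRing R] [IsLocalRing R] {u : R}
    (hu : u ∈ maximalIdeal R) (hu2 : u ∉ maximalIdeal R ^ 2) {s : Finset R}
    (hs : Ideal.span (s : Set R) = maximalIdeal R) :
    ∃ x ∈ s, maximalIdeal R = Ideal.span (insert u (s.erase x : Set R)) := by
  obtain ⟨c, -, hc⟩ := Submodule.mem_span_finset.mp (hs.symm ▸ hu : u ∈ Ideal.span (s : Set R))
  have hs_le (x : R) (hx : x ∈ s) : x ∈ maximalIdeal R := hs ▸ Ideal.subset_span hx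
  obtain ⟨x, hx, hcx⟩ : ∃ x ∈ s, IsUnit (c x) := by
    by_contra! h
    refine hu2 (hc ▸ sum_mem fun x hx => ?_)
    rw [smul_eq_mul, pow_two]
    exact Ideal.mul_mem_mul ((mem_maximalIdeal _).mpr (h x hx)) (hs_le x hx)
  refine ⟨x, hx, le_antisymm ?_ (Ideal.span_le.mpr ?_)⟩
  · rw [← hs, Ideal.span_le]
    intro y hy
    by_cases hyx : y = x
    · have hsum : c x * x = u - ∑ z ∈ s.erase x, c z * z :=
        eq_sub_of_add_eq ((Finset.add_sum_erase s (fun z => c z * z) hx).trans hc)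
      rw [hyx, SetLike.mem_coe, ← Ideal.unit_mul_mem_iff_mem _ hcx, hsum]
      exact sub_mem (Ideal.subset_span (Set.mem_insert _ _)) (sum_mem fun z hz =>
        Ideal.mul_mem_left _ _ (Ideal.subset_span (Set.mem_insert_of_mem _ hz)))
    · exact Ideal.subset_span (Set.mem_insert_of_mem _ (Finset.mem_erase.mpr ⟨hyx, hy⟩))
  · exact Set.insert_subset hu fun y hy => hs_le y (Finset.mem_of_mem_erase hy)

theorem spanFinrank_maximalIdeal_quotient_lt {u : R} (hu : u ∈ maximalIdeal R)
    (hu2 : u ∉ maximalIdeal R ^ 2) [IsLocalRing (R ⧸ Ideal.span {u})] :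
    (maximalIdeal (R ⧸ Ideal.span {u})).spanFinrank < (maximalIdeal R).spanFinrank := by
  classical
  obtain ⟨s, hcard, hs⟩ := Submodule.FG.exists_span_finset_card_eq_spanFinrank
    (maximalIdeal R).fg_of_isNoetherianRing
  obtain ⟨x, hx, hspan⟩ := exists_maximalIdeal_eq_span_insert_erase hu hu2 hs
  have hmap : maximalIdeal (R ⧸ Ideal.span {u}) =
      Ideal.span ((s.erase x).image (Ideal.Quotient.mk (Ideal.span {u})) : Set _) := by
    rw [← map_maximalIdeal_of_surjective _ Ideal.Quotient.mk_surjective, hspan, Ideal.map_span,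
      Set.image_insert_eq, Ideal.Quotient.eq_zero_iff_mem.mpr (Ideal.mem_span_singleton_self u),
      Ideal.span_insert_zero, Finset.coe_image]
  calc (maximalIdeal (R ⧸ Ideal.span {u})).spanFinrank
      ≤ (((s.erase x).image (Ideal.Quotient.mk (Ideal.span {u})) : Finset _) :
          Set (R ⧸ Ideal.span {u})).ncard := by
        rw [hmap]
        exact Submodule.spanFinrank_span_le_ncard_of_finite (Finset.finite_toSet _)
    _ ≤ (s.erase x).card := by
        rw [Set.ncard_coe_finset]
        exact Finset.card_image_le
    _ < s.card := Finset.card_erase_lt_of_mem hx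
    _ = (maximalIdeal R).spanFinrank := hcard

end NoetherianLocal

theorem isRegularLocalRing_quotient_span_singleton {S : Type*} [CommRing S] [IsRegularLocalRing S]
    {u : S} (hu : u ∈ maximalIdeal S) (hu2 : u ∉ maximalIdeal S ^ 2) :
    IsRegularLocalRing (S ⧸ Ideal.span {u}) := by
  have := isLocalRing_quotient_of_le_maximalIdeal
    ((Ideal.span_singleton_le_iff_mem _).mpr hu)
  refine IsRegularLocalRing.of_spanFinrank_maximalIdeal_le _ ?_
  have hdim : ringKrullDim S ≤ ringKrullDim (S ⧸ Ideal.span {u}) + 1 := by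
    rw [← maximalIdeal_height_eq_ringKrullDim]
    exact Ideal.height_le_ringKrullDim_quotient_add_one hu
  rw [← IsRegularLocalRing.spanFinrank_maximalIdeal] at hdim
  exact ENat.WithBot.add_le_add_one_right_iff.mp ((Nat.cast_le.mpr
    (Nat.succ_le_of_lt (spanFinrank_maximalIdeal_quotient_lt hu hu2))).trans hdim)

theorem isDomain_of_isRegularLocalRing (S : Type*) [CommRing S] [IsRegularLocalRing S] :
    IsDomain S := by
  induction hn : (maximalIdeal S).spanFinrank using Nat.strong_induction_on generalizing S with
  | _ n ih =>
    subst hn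
    by_cases hheight : 0 < (maximalIdeal S).height
    · obtain ⟨u, hu, hu2, hmin⟩ := exists_mem_maximalIdeal_notMem_sq_notMem_minimalPrimes hheight
      have := isRegularLocalRing_quotient_span_singleton hu hu2
      have := ih _ (spanFinrank_maximalIdeal_quotient_lt hu hu2) _ rfl
      exact isDomain_of_isPrime_span_singleton hu
        ((Ideal.Quotient.isDomain_iff_prime _).mp this) hmin
    · have hdim : ringKrullDim S = 0 := by
        rw [← maximalIdeal_height_eq_ringKrullDim, not_lt.mp hheight |>.antisymm zero_le]
        rfl
      have hrank : (maximalIdeal S).spanFinrank = 0 := by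
        exact_mod_cast (IsRegularLocalRing.spanFinrank_maximalIdeal (R := S)).trans hdim
      exact (isField_iff_maximalIdeal_eq.mpr ((Submodule.spanFinrank_eq_zero_iff_eq_bot
        (maximalIdeal S).fg_of_isNoetherianRing).mp hrank)).isDomain

theorem exists_maximalIdeal_eq_span_pair {S : Type*} [CommRing S] [IsRegularLocalRing S]
    (hS : ringKrullDim S = 2) :
    ∃ u v : S, maximalIdeal S = Ideal.span {u, v} ∧ Prime u ∧ ¬ u ∣ v := by
  classical
  have hrank : (maximalIdeal S).spanFinrank = 2 := by
    exact_mod_cast (IsRegularLocalRing.spanFinrank_maximalIdeal (R := S)).trans hS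
  have hheight : (maximalIdeal S).height = 2 :=
    WithBot.coe_injective (maximalIdeal_height_eq_ringKrullDim.trans hS)
  obtain ⟨u, hu, hu2, -⟩ := exists_mem_maximalIdeal_notMem_sq_notMem_minimalPrimes
    (R := S) (by rw [hheight]; exact two_pos)
  obtain ⟨s, hcard, hs⟩ := Submodule.FG.exists_span_finset_card_eq_spanFinrank
    (maximalIdeal S).fg_of_isNoetherianRing
  obtain ⟨x, hx, hspan⟩ := exists_maximalIdeal_eq_span_insert_erase hu hu2 hs
  obtain ⟨v, hv⟩ : ∃ v, s.erase x = {v} := Finset.card_eq_one.mp (by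
    rw [Finset.card_erase_of_mem hx, hcard, hrank])
  rw [hv, Finset.coe_singleton] at hspan
  refine ⟨u, v, hspan, (Ideal.span_singleton_prime ?_).mp ?_, fun huv => ?_⟩
  · rintro rfl
    exact hu2 (zero_mem _)
  · have := isRegularLocalRing_quotient_span_singleton hu hu2
    exact (Ideal.Quotient.isDomain_iff_prime _).mp (isDomain_of_isRegularLocalRing _)
  · rw [Ideal.span_pair_eq_span_left_iff_dvd.mpr huv] at hspan
    have := Submodule.spanFinrank_span_le_ncard_of_finite (R := S) (Set.finite_singleton u)
    rw [← Ideal.span, ← hspan, hrank, Set.ncard_singleton] at this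
    omega

theorem free_of_maximalIdeal_eq_span_singleton {R M : Type*} [CommRing R] [IsLocalRing R]
    [IsNoetherianRing R] [AddCommGroup M] [Module R M] [Module.Finite R M] {v : R}
    (hv : maximalIdeal R = Ideal.span {v}) (hreg : IsSMulRegular M v) : Module.Free R M := by
  have hvm : v ∈ maximalIdeal R := hv ▸ Ideal.mem_span_singleton_self v
  have := Module.finitePresentation_of_finite R M
  have : (Ideal.span {v}).IsMaximal := hv ▸ maximalIdeal.isMaximal R
  let := Ideal.Quotient.field (Ideal.span {v})
  exact (Module.free_quotSMulTop_iff_free R M (maximalIdeal_le_jacobson _ hvm) hreg).mp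
    (Module.Free.of_divisionRing (R ⧸ Ideal.span {v}) _)

section PrimePair

variable {S : Type*} [CommRing S] [IsDomain S] {u v : S}

theorem exists_smul_eq_and_smul_eq {F : Type*} [AddCommGroup F] [Module S F] [Module.Free S F]
    (hu : Prime u) (hv : ¬ u ∣ v) {x z : F} (h : v • x = u • z) :
    ∃ w, u • w = x ∧ v • w = z := by
  let b := Module.Free.chooseBasis S F
  have hdvd (i) : u ∣ b.repr x i := by
    have hcoord : v * b.repr x i = u * b.repr z i := by
      simpa using congrArg (fun t => b.repr t i) h
    exact (hu.dvd_or_dvd ⟨_, hcoord⟩).resolve_left hv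
  choose c hc using hdvd
  obtain ⟨w, rfl⟩ : ∃ w, u • w = x := by
    refine ⟨(b.repr x).sum fun i _ => c i • b i, ?_⟩
    conv_rhs => rw [← b.linearCombination_repr x, Finsupp.linearCombination_apply]
    rw [Finsupp.smul_sum]
    exact Finset.sum_congr rfl fun i _ => by simp only [hc i, mul_smul]
  refine ⟨w, rfl, smul_right_injective F hu.ne_zero ?_⟩
  exact (smul_comm u v w).trans h

theorem isSMulRegular_quotSMulTop_ker {F X : Type*} [AddCommGroup F] [Module S F]
    [Module.Free S F] [AddCommGroup X] [Module S X] (p : F →ₗ[S] X) (hu : Prime u)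
    (hv : ¬ u ∣ v) {y : S} (hy : y ∈ Ideal.span {u, v}) (hreg : IsSMulRegular X y) :
    IsSMulRegular (QuotSMulTop u (LinearMap.ker p)) v := by
  rw [isSMulRegular_iff_right_eq_zero_of_smul]
  intro m hm
  obtain ⟨⟨x, hx⟩, rfl⟩ := Submodule.mkQ_surjective _ m
  have hmem : v • (⟨x, hx⟩ : LinearMap.ker p) ∈ u • (⊤ : Submodule S (LinearMap.ker p)) := by
    rwa [← map_smul, Submodule.mkQ_apply, Submodule.Quotient.mk_eq_zero] at hm
  obtain ⟨⟨z, hz⟩, -, hzx⟩ := (Submodule.mem_smul_pointwise_iff_exists _ _ _).mp hmem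
  obtain ⟨w, rfl, rfl⟩ := exists_smul_eq_and_smul_eq hu hv (congrArg Subtype.val hzx).symm
  have hw : p w = 0 := by
    refine hreg.right_eq_zero_of_smul ?_
    obtain ⟨a, b, rfl⟩ := Ideal.mem_span_pair.mp hy
    rw [add_smul, mul_smul, mul_smul, ← map_smul, ← map_smul p v, LinearMap.mem_ker.mp hx,
      LinearMap.mem_ker.mp hz, smul_zero, smul_zero, add_zero]
  rw [Submodule.mkQ_apply, Submodule.Quotient.mk_eq_zero]
  exact (Submodule.mem_smul_pointwise_iff_exists _ _ _).mpr ⟨⟨w, hw⟩, trivial, rfl⟩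

theorem free_ker_of_isSMulRegular [IsLocalRing S] [IsNoetherianRing S]
    (huv : maximalIdeal S = Ideal.span {u, v}) (hu : Prime u) (hv : ¬ u ∣ v) {F X : Type*}
    [AddCommGroup F] [Module S F] [Module.Free S F] [Module.Finite S F] [AddCommGroup X]
    [Module S X] (p : F →ₗ[S] X) {y : S} (hy : y ∈ maximalIdeal S) (hreg : IsSMulRegular X y) :
    Module.Free S (LinearMap.ker p) := by
  have hum : u ∈ maximalIdeal S := huv ▸ Ideal.subset_span (Set.mem_insert _ _)
  have hreg_u : IsSMulRegular (LinearMap.ker p) u :=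
    isSMulRegular_iff_right_eq_zero_of_smul.mpr fun m hm =>
      (smul_eq_zero.mp hm).resolve_left hu.ne_zero
  have : Module.FinitePresentation S (LinearMap.ker p) := Module.finitePresentation_of_finite S _
  rw [← Module.free_quotSMulTop_iff_free S _ (maximalIdeal_le_jacobson _ hum) hreg_u]
  let Q := S ⧸ Ideal.span {u}
  have : IsLocalRing Q := isLocalRing_quotient_of_le_maximalIdeal
    ((Ideal.span_singleton_le_iff_mem _).mpr hum)
  have : Module.Finite Q (QuotSMulTop u (LinearMap.ker p)) :=
    Module.Finite.of_restrictScalars_finite S _ _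
  have hmax : maximalIdeal Q = Ideal.span {Ideal.Quotient.mk (Ideal.span {u}) v} := by
    rw [← map_maximalIdeal_of_surjective (Ideal.Quotient.mk (Ideal.span {u}))
      Ideal.Quotient.mk_surjective, huv, Ideal.map_span, Set.image_pair,
      Ideal.Quotient.eq_zero_iff_mem.mpr (Ideal.mem_span_singleton_self u), Ideal.span_insert_zero]
  exact free_of_maximalIdeal_eq_span_singleton hmax
    (isSMulRegular_quotSMulTop_ker p hu hv (huv ▸ hy) hreg)

theorem mem_span_of_mul_mem_span (hu : Prime u) (hv : ¬ u ∣ v) {f z : S} (hf : f ≠ 0)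
    (huz : u * z ∈ Ideal.span {f}) (hvz : v * z ∈ Ideal.span {f}) : z ∈ Ideal.span {f} := by
  obtain ⟨a, ha⟩ := Ideal.mem_span_singleton.mp huz
  obtain ⟨b, hb⟩ := Ideal.mem_span_singleton.mp hvz
  have hab : v * a = u * b := mul_left_cancel₀ hf (by linear_combination u * hb - v * ha)
  obtain ⟨c, rfl⟩ := (hu.dvd_or_dvd ⟨b, hab⟩).resolve_left hv
  exact Ideal.mem_span_singleton.mpr
    ⟨c, mul_left_cancel₀ hu.ne_zero (by linear_combination ha)⟩

end PrimePair

end RegularLocalRing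

section MatrixFactorization

/-- A matrix factorization of `f` in the sense of Eisenbud: square matrices `φ` and `ψ` whose
products in both orders are `f` times the identity. Reduced modulo `f`, the two matrices are the
differentials of a 2-periodic resolution. -/
structure IsMatrixFactorization {S n : Type*} [CommRing S] [Fintype n] [DecidableEq n] (f : S)
    (φ ψ : Matrix n n S) : Prop where
  mul_eq : φ * ψ = f • 1
  mul_eq' : ψ * φ = f • 1

variable {S : Type*} [CommRing S] [IsDomain S] {f : S}

theorem IsMatrixFactorization.symm {S n : Type*} [CommRing S] [Fintype n] [DecidableEq n] {f : S}
    {φ ψ : Matrix n n S} (h : IsMatrixFactorization f φ ψ) : IsMatrixFactorization f ψ φ :=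
  ⟨h.mul_eq', h.mul_eq⟩

theorem exists_isMatrixFactorization_range_eq {n : ℕ} (hf : f ≠ 0)
    (K : Submodule S (Fin n → S)) [Module.Free S K] [Module.Finite S K]
    (hK : ∀ g : Fin n → S, f • g ∈ K) :
    ∃ φ ψ : Matrix (Fin n) (Fin n) S,
      IsMatrixFactorization f φ ψ ∧ LinearMap.range φ.mulVecLin = K := by
  let μ : (Fin n → S) →ₗ[S] K := (LinearMap.lsmul S (Fin n → S) f).codRestrict _ hK
  have hμ : Function.Injective μ := fun g h hgh =>
    smul_right_injective _ hf (congrArg Subtype.val hgh)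
  have hrank : Module.finrank S K = n := le_antisymm
    (by simpa using LinearMap.finrank_le_finrank_of_injective K.injective_subtype)
    (by simpa using LinearMap.finrank_le_finrank_of_injective hμ)
  let e : (Fin n → S) ≃ₗ[S] K := (Module.finBasisOfFinrankEq S _ hrank).equivFun.symm
  let φ : (Fin n → S) →ₗ[S] (Fin n → S) := K.subtype ∘ₗ e.toLinearMap
  let ψ : (Fin n → S) →ₗ[S] (Fin n → S) := e.symm.toLinearMap ∘ₗ μ
  have hφ : Function.Injective φ := K.injective_subtype.comp e.injective
  have hφψ : φ ∘ₗ ψ = f • LinearMap.id := LinearMap.ext fun g =>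
    congrArg Subtype.val (e.apply_symm_apply (μ g))
  have hψφ : ψ ∘ₗ φ = f • LinearMap.id := LinearMap.ext fun g => hφ <|
    (LinearMap.congr_fun hφψ (φ g)).trans (map_smul φ f g).symm
  refine ⟨LinearMap.toMatrix' φ, LinearMap.toMatrix' ψ, ⟨?_, ?_⟩, ?_⟩
  · rw [← LinearMap.toMatrix'_comp, hφψ, map_smul, LinearMap.toMatrix'_id]
  · rw [← LinearMap.toMatrix'_comp, hψφ, map_smul, LinearMap.toMatrix'_id]
  · rw [← Matrix.toLin'_apply', Matrix.toLin'_toMatrix', LinearMap.range_comp_of_range_eq_top _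
      (LinearEquiv.range e), Submodule.range_subtype]

variable {B : Type*} [CommRing B] [Algebra S B]

theorem algebraMap_comp_eq_zero_iff {S : Type*} [CommRing S] {f : S} [Algebra S B]
    (hker : RingHom.ker (algebraMap S B) = Ideal.span {f}) {n : Type*} {g : n → S} :
    algebraMap S B ∘ g = 0 ↔ ∃ h : n → S, g = f • h := by
  have hcoord (i : n) : algebraMap S B (g i) = 0 ↔ f ∣ g i := by
    rw [← RingHom.mem_ker, hker, Ideal.mem_span_singleton]
  simp only [funext_iff, Function.comp_apply, Pi.zero_apply, hcoord, dvd_def, Pi.smul_apply,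
    smul_eq_mul, Classical.skolem]

theorem IsMatrixFactorization.ker_eq_range {n : Type*} [Fintype n] [DecidableEq n]
    {φ ψ : Matrix n n S} (h : IsMatrixFactorization f φ ψ) (hf : f ≠ 0)
    (hsurj : Function.Surjective (algebraMap S B))
    (hker : RingHom.ker (algebraMap S B) = Ideal.span {f}) :
    LinearMap.ker (φ.map (algebraMap S B)).mulVecLin =
      LinearMap.range (ψ.map (algebraMap S B)).mulVecLin := by
  have map_mulVec (χ : Matrix n n S) (g : n → S) :
      (χ.map (algebraMap S B)).mulVec (algebraMap S B ∘ g) = algebraMap S B ∘ χ.mulVec g :=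
    funext fun i => (RingHom.map_mulVec _ χ g i).symm
  have hφ : Function.Injective φ.mulVec := fun g h' hgh => smul_right_injective _ hf <| by
    simpa [Matrix.mulVec_mulVec, h.mul_eq', Matrix.smul_mulVec] using
      congrArg ψ.mulVec hgh
  ext x
  obtain ⟨g, rfl⟩ := hsurj.comp_left x
  simp only [LinearMap.mem_ker, LinearMap.mem_range, Matrix.mulVecLin_apply, map_mulVec,
    algebraMap_comp_eq_zero_iff hker]
  constructor
  · rintro ⟨w, hw⟩
    refine ⟨algebraMap S B ∘ w, ?_⟩
    rw [map_mulVec, hφ (a₁ := ψ.mulVec w) (a₂ := g)]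
    rw [Matrix.mulVec_mulVec, h.mul_eq, hw, Matrix.smul_mulVec, Matrix.one_mulVec]
  · rintro ⟨z, hz⟩
    obtain ⟨w, rfl⟩ := hsurj.comp_left z
    obtain ⟨t, ht⟩ := (algebraMap_comp_eq_zero_iff hker (g := ψ.mulVec w - g)).mp (by
      rw [← sub_eq_zero.mpr hz, map_mulVec]
      exact funext fun i => map_sub _ _ _)
    refine ⟨w - φ.mulVec t, ?_⟩
    rw [← sub_sub_self (ψ.mulVec w) g, ht, Matrix.mulVec_sub, Matrix.mulVec_mulVec, h.mul_eq,
      Matrix.mulVec_smul, Matrix.smul_mulVec, Matrix.one_mulVec, smul_sub]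

theorem exists_range_eq_ker_and_ker_equiv (hf : f ≠ 0)
    (hsurj : Function.Surjective (algebraMap S B))
    (hker : RingHom.ker (algebraMap S B) = Ideal.span {f}) {X : Type*} [AddCommGroup X]
    [Module B X] [Module S X] {n : ℕ} {π : (Fin n → B) →ₗ[B] X}
    (hπ : Function.Surjective π) {p : (Fin n → S) →ₗ[S] X}
    (hp : ∀ g, p g = π (algebraMap S B ∘ g)) [Module.Free S (LinearMap.ker p)]
    [Module.Finite S (LinearMap.ker p)] :
    ∃ φ : (Fin n → B) →ₗ[B] (Fin n → B), LinearMap.range φ = LinearMap.ker π ∧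
      Nonempty (LinearMap.ker φ ≃ₗ[B] X) := by
  obtain ⟨φ, ψ, hφψ, hφ⟩ := exists_isMatrixFactorization_range_eq hf (LinearMap.ker p)
    fun g => by
      rw [LinearMap.mem_ker, hp, (algebraMap_comp_eq_zero_iff hker).mpr ⟨g, rfl⟩, map_zero]
  let φ' := (φ.map (algebraMap S B)).mulVecLin
  let ψ' := (ψ.map (algebraMap S B)).mulVecLin
  have hφ'_apply (g : Fin n → S) : φ' (algebraMap S B ∘ g) = algebraMap S B ∘ φ.mulVec g :=
    funext fun i => (RingHom.map_mulVec _ φ g i).symm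
  have hφ' : LinearMap.range φ' = LinearMap.ker π := by
    apply le_antisymm
    · rintro _ ⟨z, rfl⟩
      obtain ⟨w, rfl⟩ := hsurj.comp_left z
      rw [hφ'_apply, LinearMap.mem_ker, ← hp, ← LinearMap.mem_ker, ← hφ]
      exact ⟨w, rfl⟩
    · intro x hx
      obtain ⟨g, rfl⟩ := hsurj.comp_left x
      obtain ⟨w, rfl⟩ : g ∈ LinearMap.range φ.mulVecLin := by
        rwa [hφ, LinearMap.mem_ker, hp]
      exact ⟨_, hφ'_apply w⟩
  have hker_φ' : LinearMap.ker φ' = LinearMap.range ψ' := hφψ.ker_eq_range hf hsurj hker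
  have hker_ψ' : LinearMap.ker ψ' = LinearMap.ker π :=
    (hφψ.symm.ker_eq_range hf hsurj hker).trans hφ'
  exact ⟨φ', hφ', ⟨LinearEquiv.ofEq _ _ hker_φ' ≪≫ₗ ψ'.quotKerEquivRange.symm ≪≫ₗ
    Submodule.quotEquivOfEq _ _ hker_ψ' ≪≫ₗ π.quotKerEquivOfSurjective hπ⟩⟩

end MatrixFactorization

section Descent

open IsLocalRing TensorProduct

theorem nonempty_ker_prod_equiv_of_range_eq {R P P' Q : Type*} [CommRing R] [AddCommGroup P]
    [Module R P] [AddCommGroup P'] [Module R P'] [AddCommGroup Q] [Module R Q]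
    [Module.Projective R P] [Module.Projective R P'] (f : P →ₗ[R] Q) (g : P' →ₗ[R] Q)
    (h : LinearMap.range f = LinearMap.range g) :
    Nonempty ((LinearMap.ker f × P') ≃ₗ[R] (LinearMap.ker g × P)) := by
  obtain ⟨b, hb⟩ := Module.projective_lifting_property g.rangeRestrict
    (f.codRestrict (LinearMap.range g) fun x => h ▸ LinearMap.mem_range_self f x)
    g.surjective_rangeRestrict
  obtain ⟨a, ha⟩ := Module.projective_lifting_property f.rangeRestrict
    (g.codRestrict (LinearMap.range f) fun x => h ▸ LinearMap.mem_range_self g x)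
    f.surjective_rangeRestrict
  have hfa (y : P') : f (a y) = g y := congrArg Subtype.val (LinearMap.congr_fun ha y)
  have hgb (x : P) : g (b x) = f x := congrArg Subtype.val (LinearMap.congr_fun hb x)
  -- Both sides are the fibre product `P ×_Q P'`; the formulas compose the two splittings.
  refine ⟨
    { toFun := fun z => (⟨z.2 - b (z.1 + a z.2), by simp [hfa, hgb]⟩, z.1 + a z.2)
      invFun := fun z => (⟨z.2 - a (z.1 + b z.2), by simp [hfa, hgb]⟩, z.1 + b z.2)
      map_add' := ?_
      map_smul' := ?_
      left_inv := ?_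
      right_inv := ?_ }⟩
  · rintro ⟨⟨k, hk⟩, y⟩ ⟨⟨k', hk'⟩, y'⟩
    refine Prod.ext (Subtype.ext ?_) ?_
    · simp only [Prod.mk_add_mk, AddMemClass.mk_add_mk, map_add]; abel
    · simp only [Prod.mk_add_mk, AddMemClass.mk_add_mk, map_add]; abel
  · rintro r ⟨⟨k, hk⟩, y⟩
    refine Prod.ext (Subtype.ext ?_) ?_ <;> simp [smul_sub, smul_add]
  · rintro ⟨⟨k, hk⟩, y⟩
    refine Prod.ext (Subtype.ext ?_) ?_ <;> simp
  · rintro ⟨⟨k, hk⟩, y⟩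
    refine Prod.ext (Subtype.ext ?_) ?_ <;> simp

section LocalExtension

variable {A B : Type*} [CommRing A] [IsNoetherianRing A] [CommRing B] [IsLocalRing B]
  [Algebra A B]

theorem exists_baseChange_sub_mem_maximalIdeal_smul [Module.Flat A B]
    (hres : ∀ b : B, ∃ a : A, b - algebraMap A B a ∈ maximalIdeal B) {M N : Type*}
    [AddCommGroup M] [Module A M] [Module.Finite A M] [AddCommGroup N] [Module A N]
    (h : B ⊗[A] M →ₗ[B] B ⊗[A] N) :
    ∃ g : M →ₗ[A] N, ∀ x,
      h x - g.baseChange B x ∈ maximalIdeal B • (⊤ : Submodule B (B ⊗[A] N)) := by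
  have : Module.FinitePresentation A M := Module.finitePresentation_of_finite A M
  refine (Module.FinitePresentation.isBaseChange_map A M N B).inductionOn h _ ?_ ?_ ?_ ?_
  · exact ⟨0, fun x => by simp⟩
  · exact fun g => ⟨g, fun x => by simp⟩
  · rintro b h ⟨g, hg⟩
    obtain ⟨a, ha⟩ := hres b
    refine ⟨a • g, fun x => ?_⟩
    have hsplit : (b • h) x - (a • g).baseChange B x =
        (b - algebraMap A B a) • h x + algebraMap A B a • (h x - g.baseChange B x) := by
      rw [LinearMap.baseChange_smul, LinearMap.smul_apply, LinearMap.smul_apply,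
        ← algebraMap_smul B a]
      module
    rw [hsplit]
    exact add_mem (Submodule.smul_mem_smul ha trivial) (Submodule.smul_mem _ _ (hg x))
  · rintro h₁ h₂ ⟨g₁, hg₁⟩ ⟨g₂, hg₂⟩
    refine ⟨g₁ + g₂, fun x => ?_⟩
    rw [LinearMap.baseChange_add, LinearMap.add_apply, LinearMap.add_apply,
      add_sub_add_comm (h₁ x)]
    exact add_mem (hg₁ x) (hg₂ x)

variable [IsLocalRing A] [Module.Flat A B] [IsLocalHom (algebraMap A B)]
  {M N : Type*} [AddCommGroup M] [Module A M] [AddCommGroup N] [Module A N]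

theorem exists_surjective_of_baseChange [Module.Finite A M] [Module.Finite A N]
    (hres : ∀ b : B, ∃ a : A, b - algebraMap A B a ∈ maximalIdeal B)
    {h : B ⊗[A] M →ₗ[B] B ⊗[A] N} (hh : Function.Surjective h) :
    ∃ g : M →ₗ[A] N, Function.Surjective g := by
  obtain ⟨g, hg⟩ := exists_baseChange_sub_mem_maximalIdeal_smul hres h
  refine ⟨g, ?_⟩
  have : Module.FaithfullyFlat A B := Module.FaithfullyFlat.of_flat_of_isLocalHom
  rw [← Module.FaithfullyFlat.lTensor_surjective_iff_surjective A B]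
  change Function.Surjective (g.baseChange B)
  rw [← LinearMap.range_eq_top, ← top_le_iff]
  refine Submodule.le_of_le_smul_of_le_jacobson_bot (I := maximalIdeal B) Module.Finite.fg_top
    (maximalIdeal_le_jacobson _) fun y _ => ?_
  obtain ⟨x, rfl⟩ := hh y
  rw [← add_sub_cancel (g.baseChange B x) (h x)]
  exact add_mem (Submodule.mem_sup_left (LinearMap.mem_range_self _ x))
    (Submodule.mem_sup_right (hg x))

theorem nonempty_equiv_of_baseChange [Module.Finite A M] [Module.Finite A N]
    (hres : ∀ b : B, ∃ a : A, b - algebraMap A B a ∈ maximalIdeal B)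
    (e : (B ⊗[A] M) ≃ₗ[B] B ⊗[A] N) : Nonempty (M ≃ₗ[A] N) := by
  obtain ⟨g, hg⟩ := exists_surjective_of_baseChange hres (h := e.toLinearMap) e.surjective
  obtain ⟨g', hg'⟩ :=
    exists_surjective_of_baseChange hres (h := e.symm.toLinearMap) e.symm.surjective
  have hinj := OrzechProperty.injective_of_surjective_endomorphism (g' ∘ₗ g) (hg'.comp hg)
  exact ⟨LinearEquiv.ofBijective g ⟨Function.Injective.of_comp hinj, hg⟩⟩

theorem exists_range_eq_ker_of_baseChange [Module.Finite A M]
    (hres : ∀ b : B, ∃ a : A, b - algebraMap A B a ∈ maximalIdeal B) {F : Type*}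
    [AddCommGroup F] [Module A F] [Module.Finite A F] {π : M →ₗ[A] N}
    {φ : B ⊗[A] F →ₗ[B] B ⊗[A] M} (hφ : LinearMap.range φ = LinearMap.ker (π.baseChange B)) :
    ∃ ρ : F →ₗ[A] M, LinearMap.range ρ = LinearMap.ker π := by
  let eK : B ⊗[A] LinearMap.ker π ≃ₗ[B] LinearMap.ker (π.baseChange B) :=
    LinearMap.tensorKerEquiv B B π
  let e : LinearMap.range φ ≃ₗ[B] B ⊗[A] LinearMap.ker π :=
    LinearEquiv.ofEq _ _ hφ ≪≫ₗ eK.symm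
  obtain ⟨ρ, hρ⟩ := exists_surjective_of_baseChange hres (h := e.toLinearMap ∘ₗ φ.rangeRestrict)
    (e.surjective.comp φ.surjective_rangeRestrict)
  refine ⟨(LinearMap.ker π).subtype ∘ₗ ρ, ?_⟩
  rw [LinearMap.range_comp_of_range_eq_top _ (LinearMap.range_eq_top.mpr hρ),
    Submodule.range_subtype]

theorem nonempty_ker_prod_equiv_of_baseChange
    (hres : ∀ b : B, ∃ a : A, b - algebraMap A B a ∈ maximalIdeal B) {F X : Type*}
    [AddCommGroup F] [Module A F] [Module.Finite A F] [Module.Projective A F] [AddCommGroup X]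
    [Module A X] [Module.Finite A X] {π : M →ₗ[A] N} {ρ : F →ₗ[A] M}
    (hρ : LinearMap.range ρ = LinearMap.ker π)
    {φ : B ⊗[A] F →ₗ[B] B ⊗[A] M} (hφ : LinearMap.range φ = LinearMap.ker (π.baseChange B))
    (e : LinearMap.ker φ ≃ₗ[B] B ⊗[A] X) :
    Nonempty ((LinearMap.ker ρ × F) ≃ₗ[A] (X × F)) := by
  have hexact : Function.Exact (ρ.baseChange B) (π.baseChange B) :=
    Module.Flat.lTensor_exact B (LinearMap.exact_iff.mpr hρ.symm)
  obtain ⟨eS⟩ := nonempty_ker_prod_equiv_of_range_eq (ρ.baseChange B) φ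
    (hφ.trans (LinearMap.exact_iff.mp hexact)).symm
  let eK : B ⊗[A] LinearMap.ker ρ ≃ₗ[B] LinearMap.ker (ρ.baseChange B) :=
    LinearMap.tensorKerEquiv B B ρ
  exact nonempty_equiv_of_baseChange hres <| TensorProduct.prodRight A B B _ _ ≪≫ₗ
    eK.prodCongr (.refl B _) ≪≫ₗ eS ≪≫ₗ e.prodCongr (.refl B _) ≪≫ₗ
      (TensorProduct.prodRight A B B _ _).symm

end LocalExtension

end Descent

section Hypersurface

open IsLocalRing TensorProduct

/-- A map `π : F → M`, thought of as a surjection from a free module, extends to a complex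
`F → F → M` exact in the middle whose next syzygy is `M` again up to a copy of `F`: a resolution
of `M` starting with `π` is 2-periodic up to free summands. -/
def IsStablyPeriodic {A F M : Type*} [CommRing A] [AddCommGroup F] [Module A F] [AddCommGroup M]
    [Module A M] (π : F →ₗ[A] M) : Prop :=
  ∃ ρ : F →ₗ[A] F, LinearMap.range ρ = LinearMap.ker π ∧
    Nonempty ((LinearMap.ker ρ × F) ≃ₗ[A] (M × F))

/-- Finitely generated modules of positive depth over the local ring `A` have resolutions that are
2-periodic up to free summands. -/
def HasPeriodicResolutions (A : Type u) [CommRing A] [IsLocalRing A] : Prop :=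
  ∀ (M : Type u) [AddCommGroup M] [Module A M] [Module.Finite A M], ∀ x ∈ maximalIdeal A,
    IsSMulRegular M x → ∀ (n : ℕ) (π : (Fin n → A) →ₗ[A] M), Function.Surjective π →
      IsStablyPeriodic π

section LocalExtension

variable {A B : Type*} [CommRing A] [CommRing B] [IsLocalRing A] [IsLocalRing B] [Algebra A B]
  [Module.Flat A B] [IsLocalHom (algebraMap A B)]

theorem ringKrullDim_eq_of_flat_of_map_maximalIdeal [IsNoetherianRing A] [IsNoetherianRing B]
    (hmap : (maximalIdeal A).map (algebraMap A B) = maximalIdeal B) :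
    ringKrullDim B = ringKrullDim A := by
  have : (maximalIdeal B).LiesOver (maximalIdeal A) :=
    ⟨(maximalIdeal_comap (algebraMap A B)).symm⟩
  have h := Ideal.height_eq_height_add_of_liesOver_of_hasGoingDown (maximalIdeal A) (maximalIdeal B)
  rw [hmap, Ideal.map_quotient_self] at h
  rw [← maximalIdeal_height_eq_ringKrullDim, ← maximalIdeal_height_eq_ringKrullDim, h,
    Ideal.height_bot, add_zero]

variable {M : Type*} [AddCommGroup M] [Module A M]

theorem isStablyPeriodic_of_baseChange [IsNoetherianRing A] [Module.Finite A M]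
    (hres : ∀ b : B, ∃ a : A, b - algebraMap A B a ∈ maximalIdeal B) {n : ℕ}
    {π : (Fin n → A) →ₗ[A] M} {φ : (Fin n → B) →ₗ[B] (Fin n → B)}
    (hφ : LinearMap.range φ = LinearMap.ker
      (π.baseChange B ∘ₗ (TensorProduct.piScalarRight A B B (Fin n)).symm.toLinearMap))
    (e : LinearMap.ker φ ≃ₗ[B] B ⊗[A] M) : IsStablyPeriodic π := by
  let E : (B ⊗[A] (Fin n → A)) ≃ₗ[B] (Fin n → B) := TensorProduct.piScalarRight A B B (Fin n)
  let φ' : B ⊗[A] (Fin n → A) →ₗ[B] B ⊗[A] (Fin n → A) :=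
    E.symm.toLinearMap ∘ₗ φ ∘ₗ E.toLinearMap
  have hrange : LinearMap.range φ' = LinearMap.ker (π.baseChange B) := by
    rw [LinearMap.range_comp, LinearMap.range_comp_of_range_eq_top _ E.range, hφ,
      LinearMap.ker_comp, Submodule.map_comap_eq_of_surjective E.symm.surjective]
  have hker : (LinearMap.ker φ).comap E.toLinearMap = LinearMap.ker φ' := by
    rw [LinearEquiv.ker_comp, LinearMap.ker_comp]
  obtain ⟨ρ, hρ⟩ := exists_range_eq_ker_of_baseChange hres hrange
  exact ⟨ρ, hρ, nonempty_ker_prod_equiv_of_baseChange hres hρ hrange <|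
    LinearEquiv.ofEq _ _ hker.symm ≪≫ₗ E.ofSubmodule' _ ≪≫ₗ e⟩

variable {S : Type*} [CommRing S] [Algebra S B]

theorem exists_isSMulRegular_tensorProduct [IsLocalRing S]
    (hsurj : Function.Surjective (algebraMap S B)) {x : A} (hx : x ∈ maximalIdeal A)
    (hreg : IsSMulRegular M x) :
    ∃ y ∈ maximalIdeal S, IsSMulRegular (B ⊗[A] M) y := by
  obtain ⟨y, hy⟩ := hsurj (algebraMap A B x)
  have hxB : algebraMap A B x ∈ maximalIdeal B := by
    rwa [mem_maximalIdeal, mem_nonunits_iff, isUnit_map_iff]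
  refine ⟨y, fun h => hxB (hy ▸ h.map (algebraMap S B)), fun z w hzw => ?_⟩
  refine hreg.of_flat_of_isBaseChange (TensorProduct.isBaseChange A M B) ?_
  change algebraMap A B x • z = algebraMap A B x • w
  rwa [← hy, algebraMap_smul, algebraMap_smul]

theorem isStablyPeriodic_of_isSMulRegular [IsNoetherianRing A] [IsRegularLocalRing S]
    (hS : ringKrullDim S = 2) {f : S} (hf : f ≠ 0) (hsurj : Function.Surjective (algebraMap S B))
    (hker : RingHom.ker (algebraMap S B) = Ideal.span {f})
    (hres : ∀ b : B, ∃ a : A, b - algebraMap A B a ∈ maximalIdeal B) [Module.Finite A M]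
    {x : A} (hx : x ∈ maximalIdeal A) (hreg : IsSMulRegular M x) {n : ℕ}
    {π : (Fin n → A) →ₗ[A] M} (hπ : Function.Surjective π) : IsStablyPeriodic π := by
  have := isDomain_of_isRegularLocalRing S
  obtain ⟨u, v, huv, hu, hv⟩ := exists_maximalIdeal_eq_span_pair hS
  obtain ⟨y, hy, hregS⟩ := exists_isSMulRegular_tensorProduct (S := S) hsurj hx hreg
  let E : (B ⊗[A] (Fin n → A)) ≃ₗ[B] (Fin n → B) := TensorProduct.piScalarRight A B B (Fin n)
  let πB : (Fin n → B) →ₗ[B] B ⊗[A] M := π.baseChange B ∘ₗ E.symm.toLinearMap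
  have hπB : Function.Surjective πB := (LinearMap.lTensor_surjective B hπ).comp E.symm.surjective
  let p : (Fin n → S) →ₗ[S] B ⊗[A] M :=
    πB.restrictScalars S ∘ₗ (Algebra.linearMap S B).compLeft (Fin n)
  have := free_ker_of_isSMulRegular huv hu hv p hy hregS
  obtain ⟨φ, hφ, ⟨e⟩⟩ := exists_range_eq_ker_and_ker_equiv hf hsurj hker hπB (p := p) fun _ => rfl
  exact isStablyPeriodic_of_baseChange hres hφ e

theorem exists_mem_maximalIdeal_isSMulRegular [IsNoetherianRing A] [IsRegularLocalRing S]
    (hS : ringKrullDim S = 2) {f : S} (hf : f ≠ 0) (hsurj : Function.Surjective (algebraMap S B))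
    (hker : RingHom.ker (algebraMap S B) = Ideal.span {f})
    (hmap : (maximalIdeal A).map (algebraMap A B) = maximalIdeal B) :
    ∃ x ∈ maximalIdeal A, IsSMulRegular A x := by
  have : Module.FaithfullyFlat A B := Module.FaithfullyFlat.of_flat_of_isLocalHom
  by_contra! h
  have hdisj : Disjoint (maximalIdeal A : Set A) (nonZeroDivisors A) :=
    Set.disjoint_left.mpr fun x hx hx' => h x hx (Module.Flat.isSMulRegular_of_nonZeroDivisors hx')
  obtain ⟨-, z, hz, hz0⟩ := SetLike.lt_iff_le_and_exists.mp
    (Ideal.bot_lt_annihilator_of_disjoint_nonZeroDivisors hdisj)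
  refine hz0 (FaithfulSMul.algebraMap_injective A B ?_)
  have hann :
      maximalIdeal B ≤ LinearMap.ker (LinearMap.toSpanSingleton B B (algebraMap A B z)) := by
    rw [← hmap, Ideal.map_le_iff_le_comap]
    intro x hx
    have hzx : z * x = 0 := congrArg Subtype.val (Module.mem_annihilator.mp hz ⟨x, hx⟩)
    rw [Ideal.mem_comap, LinearMap.mem_ker, LinearMap.toSpanSingleton_apply, smul_eq_mul,
      ← map_mul, mul_comm, hzx, map_zero]
  obtain ⟨s, hs⟩ := hsurj (algebraMap A B z)
  have := isDomain_of_isRegularLocalRing S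
  obtain ⟨u, v, huv, hu, hv⟩ := exists_maximalIdeal_eq_span_pair hS
  have hmul {t : S} (ht : t ∈ maximalIdeal S) : t * s ∈ Ideal.span {f} := by
    have := IsLocalHom.of_surjective (algebraMap S B) hsurj
    rw [← hker, RingHom.mem_ker, map_mul, hs]
    exact hann (map_mem_nonunits_iff (algebraMap S B) t |>.mpr ht)
  have hsf : s ∈ RingHom.ker (algebraMap S B) := hker ▸ mem_span_of_mul_mem_span hu hv hf
    (hmul (huv ▸ Ideal.subset_span (by simp))) (hmul (huv ▸ Ideal.subset_span (by simp)))
  rw [map_zero, ← hs, hsf]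

end LocalExtension

theorem exists_sub_algebraMap_mem_maximalIdeal {A : Type*} [CommRing A] [IsLocalRing A]
    [IsNoetherianRing A] (c : AdicCompletion (maximalIdeal A) A) :
    ∃ a : A, c - algebraMap A _ a ∈ maximalIdeal (AdicCompletion (maximalIdeal A) A) := by
  obtain ⟨r, hr⟩ := (AdicCompletion.residueField_map_bijective A).2 (residue _ c)
  obtain ⟨a, rfl⟩ := residue_surjective r
  rw [ResidueField.map_residue] at hr
  exact ⟨a, Ideal.Quotient.eq.mp hr.symm⟩

variable {A : Type u} [CommRing A] [IsLocalRing A]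

theorem IsLocalHypersurface.exists_surjective_algebraMap (hA : IsLocalHypersurface A)
    (hdim : ringKrullDim A = 1) :
    ∃ (S : Type u) (_ : CommRing S) (_ : IsRegularLocalRing S)
      (_ : Algebra S (AdicCompletion (maximalIdeal A) A)) (f : S), ringKrullDim S = 2 ∧ f ≠ 0 ∧
        Function.Surjective (algebraMap S (AdicCompletion (maximalIdeal A) A)) ∧
        RingHom.ker (algebraMap S (AdicCompletion (maximalIdeal A) A)) = Ideal.span {f} := by
  obtain ⟨_, S, _, _, f, hf, hfm, ⟨e⟩⟩ := hA
  let σ := e.symm.toRingHom.comp (Ideal.Quotient.mk (Ideal.span {f}))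
  have := isDomain_of_isRegularLocalRing S
  have := isNoetherianRing_of_ringEquiv _ e.symm
  have hS : ringKrullDim S = 2 := by
    rw [← ringKrullDim_quotient_span_singleton_succ_eq_ringKrullDim_of_mem_nonZeroDivisors
      (mem_nonZeroDivisors_of_ne_zero hf) hfm, ← ringKrullDim_eq_of_ringEquiv e,
      ringKrullDim_eq_of_flat_of_map_maximalIdeal (AdicCompletion.maximalIdeal_eq_map).symm,
      hdim, one_add_one_eq_two]
  refine ⟨S, _, inferInstance, σ.toAlgebra, f, hS, hf,
    e.symm.surjective.comp Ideal.Quotient.mk_surjective, ?_⟩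
  exact (RingHom.ker_equiv_comp _ e.symm).trans Ideal.mk_ker

theorem IsLocalHypersurface.hasPeriodicResolutions (hA : IsLocalHypersurface A)
    (hdim : ringKrullDim A = 1) : HasPeriodicResolutions A := by
  have := hA.1
  obtain ⟨S, _, _, _, f, hS, hf, hsurj, hker⟩ := hA.exists_surjective_algebraMap hdim
  intro M _ _ _ x hx hreg n π hπ
  exact isStablyPeriodic_of_isSMulRegular hS hf hsurj hker exists_sub_algebraMap_mem_maximalIdeal
    hx hreg hπ

theorem IsLocalHypersurface.exists_isSMulRegular (hA : IsLocalHypersurface A)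
    (hdim : ringKrullDim A = 1) : ∃ x ∈ maximalIdeal A, IsSMulRegular A x := by
  have := hA.1
  obtain ⟨S, _, _, _, f, hS, hf, hsurj, hker⟩ := hA.exists_surjective_algebraMap hdim
  exact exists_mem_maximalIdeal_isSMulRegular hS hf hsurj hker
    (AdicCompletion.maximalIdeal_eq_map).symm

end Hypersurface

section ExactPair

open TensorProduct

variable {A : Type u} [CommRing A] {a b : A}

theorem smul_quotient_eq_zero {I : Ideal A} {r : A} (hr : r ∈ I) (m : A ⧸ I) : r • m = 0 := by
  rw [Algebra.smul_def, Ideal.Quotient.algebraMap_eq, Ideal.Quotient.eq_zero_iff_mem.mpr hr,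
    zero_mul]

/-- An exact pair of zero divisors: each of `a` and `b` generates the annihilator of the other.
The cyclic modules `A ⧸ (a)` and `A ⧸ (b)` are then syzygies of each other. -/
structure IsExactPair (a b : A) : Prop where
  mul_eq_zero_iff : ∀ y, a * y = 0 ↔ b ∣ y
  mul_eq_zero_iff' : ∀ y, b * y = 0 ↔ a ∣ y

namespace IsExactPair

theorem symm (h : IsExactPair a b) : IsExactPair b a :=
  ⟨h.mul_eq_zero_iff', h.mul_eq_zero_iff⟩

theorem exists_injective_exact_mkQ (h : IsExactPair a b) :
    ∃ k : (A ⧸ Ideal.span {b}) →ₗ[A] A, Function.Injective k ∧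
      Function.Exact k (Ideal.span {a}).mkQ ∧ k 1 = a := by
  have hker : LinearMap.ker (LinearMap.toSpanSingleton A A a) = Ideal.span {b} := by
    ext y
    rw [LinearMap.mem_ker, LinearMap.toSpanSingleton_apply, smul_eq_mul, mul_comm,
      h.mul_eq_zero_iff, Ideal.mem_span_singleton]
  refine ⟨(Ideal.span {b}).liftQ (LinearMap.toSpanSingleton A A a) hker.ge, ?_, ?_, ?_⟩
  · rw [← LinearMap.ker_eq_bot]
    exact Submodule.ker_liftQ_eq_bot _ _ _ hker.le
  · rw [LinearMap.exact_iff, Submodule.range_liftQ, Submodule.ker_mkQ,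
      LinearMap.range_toSpanSingleton]
  · exact one_mul a

variable (N : Type u) [AddCommGroup N] [Module A N]

theorem nonempty_tor_equiv (h : IsExactPair a b) (i : ℕ) :
    Nonempty (torModule A (i + 2) (A ⧸ Ideal.span {a}) N ≃ₗ[A]
      torModule A (i + 1) (A ⧸ Ideal.span {b}) N) := by
  obtain ⟨k, hk, hex, -⟩ := h.exists_injective_exact_mkQ
  exact nonempty_tor_succ_equiv hk hex (Submodule.mkQ_surjective _) i N

theorem smul_tor_eq_zero_of_mem_sup (h : IsExactPair a b) (i : ℕ) {r : A}
    (hr : r ∈ Ideal.span {a} ⊔ Ideal.span {b})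
    (x : torModule A (i + 1) (A ⧸ Ideal.span {a}) N) : r • x = 0 := by
  obtain ⟨c, hc, d, hd, rfl⟩ := Submodule.mem_sup.mp hr
  rw [add_smul, smul_tor_eq_zero (smul_quotient_eq_zero hc), zero_add]
  obtain ⟨e⟩ := h.symm.nonempty_tor_equiv N i
  apply e.symm.injective
  rw [map_smul, smul_tor_eq_zero (smul_quotient_eq_zero hd), map_zero]

theorem exists_nonempty_tor_one_equiv_ker (h : IsExactPair a b) :
    ∃ t : (A ⧸ Ideal.span {b}) ⊗[A] N →ₗ[A] N, (∀ y, t (1 ⊗ₜ[A] y) = a • y) ∧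
      Nonempty (torModule A 1 (A ⧸ Ideal.span {a}) N ≃ₗ[A] LinearMap.ker t) := by
  obtain ⟨k, hk, hex, hk1⟩ := h.exists_injective_exact_mkQ
  obtain ⟨e⟩ := nonempty_tor_one_equiv_ker_rTensor hk hex (Submodule.mkQ_surjective _) N
  refine ⟨(TensorProduct.lid A N).toLinearMap ∘ₗ k.rTensor N, fun y => ?_,
    ⟨e ≪≫ₗ LinearEquiv.ofEq _ _ (LinearEquiv.ker_comp _ _).symm⟩⟩
  rw [LinearMap.comp_apply, LinearMap.rTensor_tmul, hk1, LinearEquiv.coe_coe,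
    TensorProduct.lid_tmul]

variable {N} in
theorem subsingleton_tor_one (h : IsExactPair a b) (ha : IsSMulRegular N a) :
    Subsingleton (torModule A 1 (A ⧸ Ideal.span {a}) N) := by
  obtain ⟨t, ht, ⟨e⟩⟩ := h.exists_nonempty_tor_one_equiv_ker N
  have hker : LinearMap.ker t = ⊥ := (Submodule.eq_bot_iff _).mpr fun z hz => by
    obtain ⟨y, rfl⟩ := TensorProduct.mk_surjective A N (A ⧸ Ideal.span {b})
      Ideal.Quotient.mk_surjective z
    rw [LinearMap.mem_ker, TensorProduct.mk_apply, ht] at hz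
    rw [ha.right_eq_zero_of_smul hz, map_zero]
  rw [hker] at e
  exact e.toEquiv.subsingleton

theorem nontrivial_tor_one [IsLocalRing A] (h : IsExactPair a b) {I : Ideal A} (hI : I ≠ ⊤)
    (ha : a ∈ I) (hb : b ∈ IsLocalRing.maximalIdeal A) :
    Nontrivial (torModule A 1 (A ⧸ Ideal.span {a}) (A ⧸ I)) := by
  obtain ⟨t, ht, ⟨e⟩⟩ := h.exists_nonempty_tor_one_equiv_ker (A ⧸ I)
  have hker : LinearMap.ker t = ⊤ := Submodule.eq_top_iff'.mpr fun z => by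
    obtain ⟨y, rfl⟩ := TensorProduct.mk_surjective A (A ⧸ I) (A ⧸ Ideal.span {b})
      Ideal.Quotient.mk_surjective z
    rw [LinearMap.mem_ker, TensorProduct.mk_apply, ht, smul_quotient_eq_zero ha]
  rw [hker] at e
  -- The tensor product of the two cyclic modules surjects onto the residue field.
  have := (Algebra.TensorProduct.productMap
    (Ideal.Quotient.factorₐ A ((Ideal.span_singleton_le_iff_mem _).mpr hb))
    (Ideal.Quotient.factorₐ A (IsLocalRing.le_maximalIdeal hI))).toRingHom.domain_nontrivial
  exact (e ≪≫ₗ Submodule.topEquiv).toEquiv.nontrivial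

end IsExactPair

end ExactPair

section PeriodicTor

open IsLocalRing

variable {A : Type u} [CommRing A]

theorem nonempty_tor_prod_equiv (L F N : Type u) [AddCommGroup L] [Module A L] [AddCommGroup F]
    [Module A F] [Module.Flat A F] [AddCommGroup N] [Module A N] (i : ℕ) :
    Nonempty (torModule A (i + 1) L N ≃ₗ[A] torModule A (i + 1) (L × F) N) := by
  obtain ⟨α, β, δ, h⟩ := exists_tor_longExact (f := LinearMap.inl A L F)
    (g := LinearMap.snd A L F) LinearMap.inl_injective .inl_snd LinearMap.snd_surjective N
  have := subsingleton_tor_of_flat (A := A) (F := F) i N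
  have := subsingleton_tor_of_flat (A := A) (F := F) (i + 1) N
  refine ⟨LinearEquiv.ofBijective (α (i + 1)) ⟨?_, fun y => ?_⟩⟩
  · refine (injective_iff_map_eq_zero _).mpr fun x hx => ?_
    obtain ⟨y, rfl⟩ := ((h (i + 1)).2.2 x).mp hx
    rw [Subsingleton.elim y 0, map_zero]
  · exact ((h (i + 1)).1 y).mp (Subsingleton.elim _ _)

theorem IsStablyPeriodic.nonempty_tor_equiv {F M : Type u} [AddCommGroup F] [Module A F]
    [Module.Flat A F] [AddCommGroup M] [Module A M] {π : F →ₗ[A] M} (h : IsStablyPeriodic π)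
    (hπ : Function.Surjective π) (i : ℕ) (N : Type u) [AddCommGroup N] [Module A N] :
    Nonempty (torModule A (i + 3) M N ≃ₗ[A] torModule A (i + 1) M N) := by
  obtain ⟨ρ, hρ, ⟨e⟩⟩ := h
  have hex : Function.Exact (LinearMap.range ρ).subtype π := by
    rw [LinearMap.exact_iff, Submodule.range_subtype, hρ]
  have hex' : Function.Exact (LinearMap.ker ρ).subtype ρ.rangeRestrict := by
    rw [LinearMap.exact_iff, Submodule.range_subtype, LinearMap.ker_rangeRestrict]
  obtain ⟨e₁⟩ := nonempty_tor_succ_equiv Subtype.val_injective hex hπ (i + 1) N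
  obtain ⟨e₂⟩ := nonempty_tor_succ_equiv Subtype.val_injective hex' ρ.surjective_rangeRestrict i N
  obtain ⟨e₃⟩ := nonempty_tor_prod_equiv (A := A) (LinearMap.ker ρ) F N i
  obtain ⟨e₄⟩ := nonempty_tor_equiv_of_equiv e (i + 1) N
  obtain ⟨e₅⟩ := nonempty_tor_prod_equiv (A := A) M F N i
  exact ⟨e₁ ≪≫ₗ e₂ ≪≫ₗ e₃ ≪≫ₗ e₄ ≪≫ₗ e₅.symm⟩

variable [IsLocalRing A]

theorem HasPeriodicResolutions.nonempty_tor_equiv [IsNoetherianRing A]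
    (hper : HasPeriodicResolutions A) {x : A} (hx : x ∈ maximalIdeal A) (hreg : IsSMulRegular A x)
    (i : ℕ) (M N : Type u) [AddCommGroup M] [Module A M] [Module.Finite A M]
    [AddCommGroup N] [Module A N] :
    Nonempty (torModule A (i + 4) M N ≃ₗ[A] torModule A (i + 2) M N) := by
  obtain ⟨n, π, hπ⟩ := Module.Finite.exists_fin' A M
  have hreg_ker : IsSMulRegular (LinearMap.ker π) x := fun y z h =>
    Subtype.ext (funext fun j => hreg (congrFun (congrArg Subtype.val h) j))
  have shift (j : ℕ) : Nonempty
      (torModule A (j + 2) M N ≃ₗ[A] torModule A (j + 1) (LinearMap.ker π) N) :=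
    nonempty_tor_succ_equiv Subtype.val_injective (LinearMap.exact_subtype_ker_map π) hπ j N
  obtain ⟨m, σ, hσ⟩ := Module.Finite.exists_fin' A (LinearMap.ker π)
  obtain ⟨e₁⟩ := shift (i + 2)
  obtain ⟨e₂⟩ := (hper _ x hx hreg_ker m σ hσ).nonempty_tor_equiv hσ i N
  obtain ⟨e₃⟩ := shift i
  exact ⟨e₁ ≪≫ₗ e₂ ≪≫ₗ e₃.symm⟩

theorem HasPeriodicResolutions.exists_eq_span_singleton (hper : HasPeriodicResolutions A)
    {x : A} (hx : x ∈ maximalIdeal A) {I : Ideal A} (hreg : ∀ y, x * y ∈ I → y ∈ I) :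
    ∃ a, I = Ideal.span {a} := by
  let e : (Fin 1 → A) ≃ₗ[A] A := LinearEquiv.funUnique (Fin 1) A A
  have hregI : IsSMulRegular (A ⧸ I) x := by
    refine isSMulRegular_iff_right_eq_zero_of_smul.mpr fun y hy => ?_
    obtain ⟨y, rfl⟩ := Ideal.Quotient.mk_surjective y
    exact Ideal.Quotient.eq_zero_iff_mem.mpr (hreg y (Ideal.Quotient.eq_zero_iff_mem.mp hy))
  obtain ⟨ρ, hρ, -⟩ := hper (A ⧸ I) x hx hregI 1 (I.mkQ ∘ₗ e.toLinearMap)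
    (I.mkQ_surjective.comp e.surjective)
  let ρ' : A →ₗ[A] A := e.toLinearMap ∘ₗ ρ ∘ₗ e.symm.toLinearMap
  have hρ' : LinearMap.range ρ' = I := by
    rw [LinearMap.range_comp, LinearMap.range_comp_of_range_eq_top _ e.symm.range, hρ,
      LinearMap.ker_comp, Submodule.map_comap_eq_of_surjective e.surjective, Submodule.ker_mkQ]
  refine ⟨ρ' 1, ?_⟩
  rw [← hρ', LinearMap.range_eq_map, ← Ideal.span_singleton_one, Ideal.span,
    Submodule.map_span, Set.image_singleton]

end PeriodicTor

section Curve

open IsLocalRing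

section FiniteLength

variable {A : Type*} [CommRing A]

theorem isArtinianRing_quotient_of_forall_isMaximal [IsNoetherianRing A] {J : Ideal A}
    (hJ : ∀ q : Ideal A, q.IsPrime → J ≤ q → q.IsMaximal) : IsArtinianRing (A ⧸ J) := by
  rw [isArtinianRing_iff_krullDimLE_zero]
  refine Ring.KrullDimLE.mk₀ fun q hq => ?_
  have hle : J ≤ q.comap (Ideal.Quotient.mk J) := fun y hy => by
    rw [Ideal.mem_comap, Ideal.Quotient.eq_zero_iff_mem.mpr hy]
    exact q.zero_mem
  have := hJ _ (hq.comap _) hle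
  rw [← Ideal.map_comap_of_surjective (Ideal.Quotient.mk J) Ideal.Quotient.mk_surjective q]
  exact Ideal.IsMaximal.map_of_surjective_of_ker_le Ideal.Quotient.mk_surjective
    (Ideal.mk_ker.trans_le hle)

theorem length_ne_top_of_isArtinianRing_quotient {T : Type*} [AddCommGroup T] [Module A T]
    [Module.Finite A T] {J : Ideal A} [IsArtinianRing (A ⧸ J)]
    (hT : ∀ r ∈ J, ∀ t : T, r • t = 0) : Module.length A T ≠ ⊤ := by
  have htors : Module.IsTorsionBySet A T J := fun t r => hT r r.2 t
  let _ := htors.module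
  have : Module.Finite (A ⧸ J) T := Module.Finite.of_restrictScalars_finite A _ T
  rw [Module.length_eq_of_surjective (R := A ⧸ J) Ideal.Quotient.mk_surjective]
  exact Module.length_ne_top

theorem length_ne_top_of_exact {X Y Z : Type*} [AddCommGroup X] [Module A X] [AddCommGroup Y]
    [Module A Y] [AddCommGroup Z] [Module A Z] {f : X →ₗ[A] Y} {g : Y →ₗ[A] Z}
    (h : Function.Exact f g) (hX : Module.length A X ≠ ⊤) (hZ : Module.length A Z ≠ ⊤) :
    Module.length A Y ≠ ⊤ := by
  rw [Module.length_ne_top_iff, isFiniteLength_iff_isNoetherian_isArtinian] at hX hZ ⊢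
  obtain ⟨⟨_, _⟩, ⟨_, _⟩⟩ := hX, hZ
  exact ⟨isNoetherian_of_range_eq_ker f g h.linearMap_ker_eq.symm,
    isArtinian_of_range_eq_ker f g h.linearMap_ker_eq.symm⟩

end FiniteLength

variable {A : Type u} [CommRing A] [IsLocalRing A]

theorem mem_minimalPrimes_iff_ne_maximalIdeal (hdim : ringKrullDim A = 1) {p : Ideal A}
    [p.IsPrime] : p ∈ minimalPrimes A ↔ p ≠ maximalIdeal A := by
  have hheight : (maximalIdeal A).height = 1 :=
    WithBot.coe_injective (maximalIdeal_height_eq_ringKrullDim.trans hdim)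
  rw [← Ideal.height_eq_zero_iff]
  constructor
  · rintro hp rfl
    exact one_ne_zero (hheight.symm.trans hp)
  · intro hp
    have h := Ideal.height_add_one_le_of_lt_of_isPrime
      (lt_of_le_of_ne (le_maximalIdeal Ideal.IsPrime.ne_top') hp)
    rw [hheight, ← ENat.lt_add_one_iff ENat.one_ne_top, ENat.add_lt_add_iff_right ENat.one_ne_top,
      Order.lt_one_iff] at h
    exact h

theorem length_ne_top_of_forall_smul_eq_zero [IsNoetherianRing A] (hdim : ringKrullDim A = 1)
    {T : Type*} [AddCommGroup T] [Module A T] [Module.Finite A T] {J : Ideal A}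
    (hJ : ∀ p ∈ minimalPrimes A, ¬ J ≤ p) (hT : ∀ r ∈ J, ∀ t : T, r • t = 0) :
    Module.length A T ≠ ⊤ := by
  have := isArtinianRing_quotient_of_forall_isMaximal (J := J) fun q _ hq => by
    have hqm : q = maximalIdeal A := by
      by_contra hne
      exact hJ q ((mem_minimalPrimes_iff_ne_maximalIdeal hdim).mpr hne) hq
    exact hqm ▸ maximalIdeal.isMaximal A
  exact length_ne_top_of_isArtinianRing_quotient hT

theorem HasIsolatedSingularity.isField (hsing : HasIsolatedSingularity A) {p : Ideal A}
    [p.IsPrime] (hp : p ∈ minimalPrimes A) (hpm : p ≠ maximalIdeal A) :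
    IsField (Localization.AtPrime p) := by
  have := hsing p hpm
  have h := IsRegularLocalRing.spanFinrank_maximalIdeal (R := Localization.AtPrime p)
  rw [IsLocalization.AtPrime.ringKrullDim_eq_height p, Ideal.height_eq_zero_iff.mpr hp] at h
  rw [isField_iff_maximalIdeal_eq, ← Submodule.spanFinrank_eq_zero_iff_eq_bot
    (maximalIdeal (Localization.AtPrime p)).fg_of_isNoetherianRing]
  exact_mod_cast h

theorem exists_mul_eq_zero_of_isField {A : Type*} [CommRing A] {p : Ideal A} [p.IsPrime]
    (hp : IsField (Localization.AtPrime p)) {a : A} (ha : a ∈ p) : ∃ s ∉ p, a * s = 0 := by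
  have hmem := (IsLocalization.AtPrime.to_map_mem_maximal_iff (Localization.AtPrime p) p a).mpr ha
  rw [isField_iff_maximalIdeal_eq.mp hp, Ideal.mem_bot,
    IsLocalization.map_eq_zero_iff p.primeCompl] at hmem
  obtain ⟨s, hs⟩ := hmem
  exact ⟨s, s.2, mul_comm a s ▸ hs⟩

/-- A one-dimensional local ring with isolated singularity, of positive depth, whose resolutions
are 2-periodic: what the computation of the theta invariant needs to know about a hypersurface. -/
structure IsPeriodicCurve (A : Type u) [CommRing A] [IsLocalRing A] : Prop where
  periodic : HasPeriodicResolutions A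
  isolated : HasIsolatedSingularity A
  dim_eq_one : ringKrullDim A = 1
  exists_regular : ∃ x ∈ maximalIdeal A, IsSMulRegular A x

theorem IsLocalHypersurface.isPeriodicCurve (hA : IsLocalHypersurface A)
    (hsing : HasIsolatedSingularity A) (hdim : ringKrullDim A = 1) : IsPeriodicCurve A :=
  ⟨hA.hasPeriodicResolutions hdim, hsing, hdim, hA.exists_isSMulRegular hdim⟩

namespace IsPeriodicCurve

theorem exists_isExactPair (hA : IsPeriodicCurve A) {p : Ideal A} (hp : p ∈ minimalPrimes A) :
    ∃ a b, p = Ideal.span {a} ∧ IsExactPair a b ∧ b ∉ p := by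
  have hpp : p.IsPrime := hp.1.1
  have hpm := (mem_minimalPrimes_iff_ne_maximalIdeal hA.dim_eq_one).mp hp
  obtain ⟨z, hz, hzp⟩ := SetLike.exists_of_lt (lt_of_le_of_ne (le_maximalIdeal hpp.ne_top) hpm)
  obtain ⟨a, ha⟩ := hA.periodic.exists_eq_span_singleton hz fun y hy =>
    (hpp.mem_or_mem hy).resolve_left hzp
  obtain ⟨x, hx, hreg⟩ := hA.exists_regular
  let annA : Ideal A := LinearMap.ker (LinearMap.toSpanSingleton A A a)
  have mem_annA (y : A) : y ∈ annA ↔ a * y = 0 := by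
    rw [LinearMap.mem_ker, LinearMap.toSpanSingleton_apply, smul_eq_mul, mul_comm]
  obtain ⟨b, hb⟩ := hA.periodic.exists_eq_span_singleton hx (I := annA) fun y hy => by
    rw [mem_annA, mul_left_comm] at hy
    exact (mem_annA y).mpr (hreg.right_eq_zero_of_smul hy)
  have hab (y : A) : a * y = 0 ↔ b ∣ y := by rw [← mem_annA, hb, Ideal.mem_span_singleton]
  have hbp : b ∉ p := fun hbp => by
    obtain ⟨s, hs, has⟩ := exists_mul_eq_zero_of_isField (hA.isolated.isField hp hpm)
      (ha ▸ Ideal.mem_span_singleton_self a)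
    exact hs (p.mem_of_dvd ((hab s).mp has) hbp)
  refine ⟨a, b, ha, ⟨hab, fun y => ⟨fun hy => ?_, ?_⟩⟩, hbp⟩
  · rw [← Ideal.mem_span_singleton, ← ha]
    exact (hpp.mem_or_mem (hy ▸ p.zero_mem : b * y ∈ p)).resolve_left hbp
  · rintro ⟨c, rfl⟩
    rw [← mul_assoc, mul_comm b a, (hab b).mpr dvd_rfl, zero_mul]

variable [IsNoetherianRing A] (hA : IsPeriodicCurve A)
include hA

theorem length_tor_quotient_prime_ne_top (i : ℕ) (p : Ideal A) [hp : p.IsPrime] (N : Type u)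
    [AddCommGroup N] [Module A N] [Module.Finite A N] :
    Module.length A (torModule A (i + 1) (A ⧸ p) N) ≠ ⊤ := by
  have := finite_tor (A := A) i (A ⧸ p) N
  by_cases hpm : p = maximalIdeal A
  · refine length_ne_top_of_forall_smul_eq_zero hA.dim_eq_one (J := p) (fun q hq hpq => ?_)
      fun r hr => smul_tor_eq_zero (smul_quotient_eq_zero hr) i N
    have := hq.1.1
    exact (mem_minimalPrimes_iff_ne_maximalIdeal hA.dim_eq_one).mp hq
      (le_antisymm (le_maximalIdeal hq.1.1.ne_top) (hpm ▸ hpq))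
  · obtain ⟨a, b, rfl, hab, hb⟩ := hA.exists_isExactPair
      ((mem_minimalPrimes_iff_ne_maximalIdeal hA.dim_eq_one).mpr hpm)
    refine length_ne_top_of_forall_smul_eq_zero hA.dim_eq_one
      (J := Ideal.span {a} ⊔ Ideal.span {b}) (fun q hq hle => hb ?_)
      fun r hr => hab.smul_tor_eq_zero_of_mem_sup N i hr
    rw [sup_le_iff, Ideal.span_singleton_le_iff_mem q (x := b)] at hle
    exact hq.2 ⟨hp, bot_le⟩ hle.1 hle.2

theorem length_tor_ne_top (i : ℕ) (M N : Type u) [AddCommGroup M] [Module A M]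
    [hM : Module.Finite A M] [AddCommGroup N] [Module A N] [Module.Finite A N] :
    Module.length A (torModule A (i + 1) M N) ≠ ⊤ := by
  induction hM using IsNoetherianRing.induction_on_isQuotientEquivQuotientPrime A with
  | subsingleton M =>
    have := subsingleton_tor_of_flat (A := A) (F := M) i N
    rw [Module.length_eq_zero]
    exact ENat.zero_ne_top
  | quotient M p e =>
    have := p.2
    obtain ⟨e'⟩ := nonempty_tor_equiv_of_equiv e (i + 1) N
    rw [e'.length_eq]
    exact hA.length_tor_quotient_prime_ne_top i p.1 N
  | exact M₁ M₂ M₃ f g hf hg hfg h₁ h₃ =>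
    obtain ⟨α, β, δ, h⟩ := exists_tor_longExact hf hfg hg N
    exact length_ne_top_of_exact (h (i + 1)).1 h₁ h₃

end IsPeriodicCurve

end Curve

section Theta

theorem length_toNat_eq_of_exact {A X Y Z : Type*} [CommRing A] [AddCommGroup X] [Module A X]
    [AddCommGroup Y] [Module A Y] [AddCommGroup Z] [Module A Z] {f : X →ₗ[A] Y} {g : Y →ₗ[A] Z}
    (h : Function.Exact f g) (hY : Module.length A Y ≠ ⊤) :
    (Module.length A Y).toNat = (Module.length A (LinearMap.range f)).toNat +
      (Module.length A (LinearMap.range g)).toNat := by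
  have hadd := Module.length_eq_add_of_exact (LinearMap.ker g).subtype g.rangeRestrict
    Subtype.val_injective (LinearMap.surjective_rangeRestrict _)
    (by rw [LinearMap.exact_iff, Submodule.range_subtype, LinearMap.ker_rangeRestrict])
  rw [h.linearMap_ker_eq] at hadd
  rw [hadd] at hY ⊢
  exact ENat.toNat_add (WithTop.add_ne_top.mp hY).1 (WithTop.add_ne_top.mp hY).2

theorem eq_zero_of_forall_sub_eq_of_forall_le {c : ℕ → ℕ} {C : ℕ} {d : ℤ}
    (hd : ∀ e, (c (e + 1) : ℤ) - c e = d) (hc : ∀ e, c e ≤ C) : d = 0 := by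
  have hlin (e : ℕ) : (c e : ℤ) - c 0 = e * d := by
    induction e with
    | zero => simp
    | succ e ih => rw [← sub_add_sub_cancel _ (c e : ℤ), ih, hd]; push_cast; ring
  have hlt : |((C + 1 : ℕ) : ℤ) * d| < ((C + 1 : ℕ) : ℤ) := by
    rw [← hlin, abs_lt]
    have := hc 0
    have := hc (C + 1)
    omega
  have hmul := Int.eq_zero_of_abs_lt_dvd (dvd_mul_right _ _) hlt
  exact (mul_eq_zero.mp hmul).resolve_left (Nat.cast_ne_zero.mpr C.succ_ne_zero)

variable {A : Type u} [CommRing A] {M M' M'' : Type u} [AddCommGroup M] [Module A M]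
  [AddCommGroup M'] [Module A M'] [AddCommGroup M''] [Module A M'']

theorem hochsterTheta_congr (φ : M ≃ₗ[A] M') (e : ℕ) (N : Type u) [AddCommGroup N] [Module A N] :
    hochsterTheta A e M N = hochsterTheta A e M' N := by
  obtain ⟨e₁⟩ := nonempty_tor_equiv_of_equiv φ (2 * e + 2) N
  obtain ⟨e₂⟩ := nonempty_tor_equiv_of_equiv φ (2 * e + 1) N
  rw [hochsterTheta, hochsterTheta, e₁.length_eq, e₂.length_eq]

theorem hochsterTheta_comm (e : ℕ) (M N : Type u) [AddCommGroup M] [Module A M] [AddCommGroup N]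
    [Module A N] : hochsterTheta A e M N = hochsterTheta A e N M := by
  obtain ⟨e₁⟩ := nonempty_tor_comm (A := A) M N (2 * e + 1)
  obtain ⟨e₂⟩ := nonempty_tor_comm (A := A) M N (2 * e)
  rw [hochsterTheta, hochsterTheta, e₁.length_eq, e₂.length_eq]

theorem hochsterTheta_eq_zero_of_flat (e : ℕ) (F N : Type u) [AddCommGroup F] [Module A F]
    [Module.Flat A F] [AddCommGroup N] [Module A N] : hochsterTheta A e F N = 0 := by
  have := subsingleton_tor_of_flat (A := A) (F := F) (2 * e + 1) N
  have := subsingleton_tor_of_flat (A := A) (F := F) (2 * e) N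
  rw [hochsterTheta, Module.length_eq_zero, Module.length_eq_zero, sub_self]

namespace IsExactPair

variable {a b : A} {N : Type u} [AddCommGroup N] [Module A N]

theorem hochsterTheta_succ (h : IsExactPair a b) (e : ℕ) :
    hochsterTheta A (e + 1) (A ⧸ Ideal.span {a}) N =
      hochsterTheta A e (A ⧸ Ideal.span {a}) N := by
  have hlength (i : ℕ) : Module.length A (torModule A (i + 3) (A ⧸ Ideal.span {a}) N) =
      Module.length A (torModule A (i + 1) (A ⧸ Ideal.span {a}) N) := by
    obtain ⟨φ⟩ := h.nonempty_tor_equiv N (i + 1)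
    obtain ⟨ψ⟩ := h.symm.nonempty_tor_equiv N i
    exact (φ.trans ψ).length_eq
  rw [hochsterTheta, hochsterTheta]
  congr 3
  · exact hlength (2 * e + 1)
  · exact hlength (2 * e)

theorem hochsterTheta_zero_pos (h : IsExactPair a b)
    (ha : Subsingleton (torModule A 1 (A ⧸ Ideal.span {a}) N))
    (hb : Nontrivial (torModule A 1 (A ⧸ Ideal.span {b}) N))
    (hfin : Module.length A (torModule A 2 (A ⧸ Ideal.span {a}) N) ≠ ⊤) :
    0 < hochsterTheta A 0 (A ⧸ Ideal.span {a}) N := by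
  obtain ⟨φ⟩ := h.nonempty_tor_equiv N 0
  have hpos : Module.length A (torModule A 2 (A ⧸ Ideal.span {a}) N) ≠ 0 :=
    φ.length_eq ▸ Module.length_pos.ne'
  rw [hochsterTheta, Module.length_eq_zero (M := torModule A (2 * 0 + 1) _ N), ENat.toNat_zero,
    Nat.cast_zero, sub_zero, Nat.cast_pos, Nat.pos_iff_ne_zero, Ne, ENat.toNat_eq_zero]
  exact not_or.mpr ⟨hpos, hfin⟩

end IsExactPair

/-- The modules `Tor_i(M, N)` have finite length for `i ≥ 1`, and this length is 2-periodic from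
`i = 2` on, so that `hochsterTheta A e M N` is meaningful and the same for all `e ≥ 1`. -/
structure HasFinitePeriodicTor (A : Type u) [CommRing A] (M N : Type u) [AddCommGroup M]
    [Module A M] [AddCommGroup N] [Module A N] : Prop where
  length_ne_top (i : ℕ) : Module.length A (torModule A (i + 1) M N) ≠ ⊤
  length_add_two (i : ℕ) :
    Module.length A (torModule A (i + 4) M N) = Module.length A (torModule A (i + 2) M N)

theorem IsPeriodicCurve.hasFinitePeriodicTor [IsLocalRing A] [IsNoetherianRing A]
    (hA : IsPeriodicCurve A) (M N : Type u) [AddCommGroup M] [Module A M] [Module.Finite A M]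
    [AddCommGroup N] [Module A N] [Module.Finite A N] : HasFinitePeriodicTor A M N where
  length_ne_top i := hA.length_tor_ne_top i M N
  length_add_two i := by
    obtain ⟨x, hx, hreg⟩ := hA.exists_regular
    obtain ⟨e⟩ := hA.periodic.nonempty_tor_equiv hx hreg i M N
    exact e.length_eq

namespace HasFinitePeriodicTor

variable {N : Type u} [AddCommGroup N] [Module A N]

theorem length_two_mul_add_two (h : HasFinitePeriodicTor A M N) (e : ℕ) :
    Module.length A (torModule A (2 * e + 2) M N) = Module.length A (torModule A 2 M N) := by
  induction e with
  | zero => rfl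
  | succ e ih => exact (h.length_add_two (2 * e)).trans ih

theorem hochsterTheta_succ (h : HasFinitePeriodicTor A M N) (e : ℕ) :
    hochsterTheta A (e + 1) M N = hochsterTheta A 1 M N := by
  induction e with
  | zero => rfl
  | succ e ih =>
    rw [← ih, hochsterTheta, hochsterTheta]
    congr 3
    · exact h.length_add_two (2 * e + 2)
    · exact h.length_add_two (2 * e + 1)

/- `c i` is the length of the image of the connecting map `Tor_{i+1}(M'', N) → Tor_i(M', N)`. -/
theorem exists_length_tor_add_eq {f : M' →ₗ[A] M} {g : M →ₗ[A] M''}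
    (h' : HasFinitePeriodicTor A M' N) (h : HasFinitePeriodicTor A M N)
    (h'' : HasFinitePeriodicTor A M'' N) (hf : Function.Injective f) (hfg : Function.Exact f g)
    (hg : Function.Surjective g) : ∃ c : ℕ → ℕ, ∀ i,
      c (i + 1) ≤ (Module.length A (torModule A (i + 1) M' N)).toNat ∧
      (Module.length A (torModule A (i + 1) M' N)).toNat +
        (Module.length A (torModule A (i + 1) M'' N)).toNat =
          (Module.length A (torModule A (i + 1) M N)).toNat + c (i + 1) + c i := by
  obtain ⟨α, β, δ, hex⟩ := exists_tor_longExact hf hfg hg N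
  refine ⟨fun i => (Module.length A (LinearMap.range (δ i))).toNat, fun i => ?_⟩
  have hM' := length_toNat_eq_of_exact (hex (i + 1)).2.2 (h'.length_ne_top i)
  have hM := length_toNat_eq_of_exact (hex (i + 1)).1 (h.length_ne_top i)
  have hM'' := length_toNat_eq_of_exact (hex i).2.1 (h''.length_ne_top i)
  dsimp only
  omega

theorem hochsterTheta_eq_add_of_exact {f : M' →ₗ[A] M} {g : M →ₗ[A] M''}
    (h' : HasFinitePeriodicTor A M' N) (h : HasFinitePeriodicTor A M N)
    (h'' : HasFinitePeriodicTor A M'' N) (hf : Function.Injective f) (hfg : Function.Exact f g)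
    (hg : Function.Surjective g) :
    hochsterTheta A 1 M N = hochsterTheta A 1 M' N + hochsterTheta A 1 M'' N := by
  obtain ⟨c, hc⟩ := exists_length_tor_add_eq h' h h'' hf hfg hg
  suffices hochsterTheta A 1 M' N - hochsterTheta A 1 M N + hochsterTheta A 1 M'' N = 0 by
    linarith
  refine eq_zero_of_forall_sub_eq_of_forall_le (c := fun e => c (2 * e + 2)) (fun e => ?_)
    fun e => (hc (2 * e + 1)).1.trans_eq (congrArg ENat.toNat (h'.length_two_mul_add_two e))
  have heven := (hc (2 * e + 2 + 1)).2
  have hodd := (hc (2 * e + 2)).2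
  rw [← h'.hochsterTheta_succ e, ← h.hochsterTheta_succ e, ← h''.hochsterTheta_succ e,
    hochsterTheta, hochsterTheta, hochsterTheta, Nat.mul_succ]
  rw [add_assoc (2 * e + 2) 1 1, one_add_one_eq_two] at heven
  omega

end HasFinitePeriodicTor

end Theta

section WeightedLaplacian

open Finset

variable {ι R : Type*} {w : ι → ι → R}

theorem neg_two_mul_sum_mul_mul [Fintype ι] [CommRing R] (hw : ∀ i j, w i j = w j i)
    (hrow : ∀ i, ∑ j, w i j = 0) (x y : ι → R) :
    -2 * ∑ i, ∑ j, w i j * (x i * y j) =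
      ∑ i, ∑ j, w i j * ((x i - x j) * (y i - y j)) := by
  have hdiag : ∑ i, ∑ j, w i j * (x i * y i) = 0 :=
    sum_eq_zero fun i _ => by rw [← sum_mul, hrow, zero_mul]
  have hdiag' : ∑ i, ∑ j, w i j * (x j * y j) = 0 := by
    rw [sum_comm, ← hdiag]
    exact sum_congr rfl fun i _ => sum_congr rfl fun j _ => by rw [hw]
  have hswap : ∑ i, ∑ j, w i j * (x j * y i) = ∑ i, ∑ j, w i j * (x i * y j) := by
    rw [sum_comm]
    exact sum_congr rfl fun i _ => sum_congr rfl fun j _ => by rw [hw]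
  simp only [sub_mul, mul_sub, sum_sub_distrib, hdiag, hdiag', hswap]
  ring

variable [CommRing R] [LinearOrder R] [IsStrictOrderedRing R]

theorem mul_sub_mul_sub_self_nonneg (hpos : ∀ i j, i ≠ j → 0 < w i j) (x : ι → R) (i j : ι) :
    0 ≤ w i j * ((x i - x j) * (x i - x j)) := by
  obtain rfl | hij := eq_or_ne i j
  · rw [sub_self, zero_mul, mul_zero]
  · exact mul_nonneg (hpos i j hij).le (mul_self_nonneg _)

variable [Fintype ι]

theorem sum_mul_sub_mul_sub_self_nonneg (hpos : ∀ i j, i ≠ j → 0 < w i j) (x : ι → R) :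
    0 ≤ ∑ i, ∑ j, w i j * ((x i - x j) * (x i - x j)) :=
  sum_nonneg fun i _ => sum_nonneg fun j _ => mul_sub_mul_sub_self_nonneg hpos x i j

theorem sum_mul_sub_mul_sub_self_eq_zero_iff (hpos : ∀ i j, i ≠ j → 0 < w i j) (x : ι → R) :
    ∑ i, ∑ j, w i j * ((x i - x j) * (x i - x j)) = 0 ↔ ∀ i j, x i = x j := by
  have hnonneg := mul_sub_mul_sub_self_nonneg hpos x
  constructor
  · intro h i j
    obtain rfl | hij := eq_or_ne i j
    · rfl
    have hi := (sum_eq_zero_iff_of_nonneg fun i _ => sum_nonneg fun j _ => hnonneg i j).mp h i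
      (mem_univ i)
    have hj := (sum_eq_zero_iff_of_nonneg fun j _ => hnonneg i j).mp hi j (mem_univ j)
    exact sub_eq_zero.mp (mul_self_eq_zero.mp ((mul_eq_zero.mp hj).resolve_left (hpos i j hij).ne'))
  · intro h
    exact sum_eq_zero fun i _ => sum_eq_zero fun j _ => by rw [h i j, sub_self, zero_mul, mul_zero]

end WeightedLaplacian

section RankFormula

open IsLocalRing Module

section RankAtStalk

variable {A : Type*} [CommRing A] {M M' M'' : Type*} [AddCommGroup M] [Module A M]
  [AddCommGroup M'] [Module A M'] [AddCommGroup M''] [Module A M'']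

theorem rankAtStalk_eq_zero_of_smul_eq_zero (p : PrimeSpectrum A) {s : A} (hs : s ∉ p.asIdeal)
    (h : ∀ m : M, s • m = 0) : rankAtStalk M p = 0 := by
  have : Subsingleton (LocalizedModule p.asIdeal.primeCompl M) :=
    notMem_support_iff.mp (notMem_support_iff'.mpr fun m => ⟨s, hs, h m⟩)
  exact finrank_zero_of_subsingleton

theorem rankAtStalk_eq_add_of_exact (p : PrimeSpectrum A)
    [IsDomain (Localization.AtPrime p.asIdeal)] [Module.Finite A M] {f : M' →ₗ[A] M}
    {g : M →ₗ[A] M''} (hf : Function.Injective f) (hfg : Function.Exact f g)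
    (hg : Function.Surjective g) : rankAtStalk M p = rankAtStalk M' p + rankAtStalk M'' p := by
  let f' := LocalizedModule.map p.asIdeal.primeCompl f
  let g' := LocalizedModule.map p.asIdeal.primeCompl g
  have hf' : Function.Injective f' := IsLocalizedModule.map_injective _ _ _ f hf
  have hg' : Function.Surjective g' := IsLocalizedModule.map_surjective _ _ _ g hg
  have hfg' : Function.Exact f' g' := LocalizedModule.map_exact _ f g hfg
  have h := (LinearMap.range f').finrank_quotient_add_finrank
  rw [LinearMap.finrank_range_of_inj hf', ← hfg'.linearMap_ker_eq,
    (g'.quotKerEquivOfSurjective hg').finrank_eq] at h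
  rw [rankAtStalk, rankAtStalk, rankAtStalk, ← h, add_comm]

end RankAtStalk

/-- The minimal primes of `A` as points of the spectrum, the indices of the rank vector of a
module. -/
abbrev MinimalPrime (A : Type*) [CommRing A] : Type _ :=
  {p : PrimeSpectrum A // p.asIdeal ∈ minimalPrimes A}

noncomputable instance MinimalPrime.instFintype (A : Type*) [CommRing A] [IsNoetherianRing A] :
    Fintype (MinimalPrime A) :=
  ((minimalPrimes.finite_of_isNoetherianRing A).preimage
    fun _ _ _ _ h => PrimeSpectrum.ext h).fintype

/-- The residue ring `A ⧸ p` at a minimal prime `p`. -/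
abbrev MinimalPrime.Quotient {A : Type*} [CommRing A] (p : MinimalPrime A) : Type _ :=
  A ⧸ p.1.asIdeal

theorem MinimalPrime.eq_of_le {A : Type*} [CommRing A] {p q : MinimalPrime A}
    (h : p.1.asIdeal ≤ q.1.asIdeal) : p = q :=
  Subtype.ext (PrimeSpectrum.ext (h.antisymm (q.2.2 ⟨p.1.2, bot_le⟩ h)))

theorem rankAtStalk_quotient_eq_zero {A : Type*} [CommRing A] {I : Ideal A} (p : PrimeSpectrum A)
    (h : ¬ I ≤ p.asIdeal) : rankAtStalk (A ⧸ I) p = 0 := by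
  obtain ⟨s, hs, hsp⟩ := SetLike.not_le_iff_exists.mp h
  exact rankAtStalk_eq_zero_of_smul_eq_zero p hsp (smul_quotient_eq_zero hs)

variable {A : Type u} [CommRing A] [IsLocalRing A]

namespace IsPeriodicCurve

section Rank

variable (hA : IsPeriodicCurve A)
include hA

theorem not_maximalIdeal_le (p : MinimalPrime A) : ¬ maximalIdeal A ≤ p.1.asIdeal := fun h =>
  (mem_minimalPrimes_iff_ne_maximalIdeal hA.dim_eq_one).mp p.2
    ((le_maximalIdeal p.1.2.ne_top).antisymm h)

theorem rankAtStalk_eq_add_of_exact (p : MinimalPrime A) {M M' M'' : Type*}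
    [AddCommGroup M] [Module A M] [Module.Finite A M] [AddCommGroup M'] [Module A M']
    [AddCommGroup M''] [Module A M''] {f : M' →ₗ[A] M} {g : M →ₗ[A] M''}
    (hf : Function.Injective f) (hfg : Function.Exact f g) (hg : Function.Surjective g) :
    rankAtStalk M p.1 = rankAtStalk M' p.1 + rankAtStalk M'' p.1 := by
  have := (hA.isolated.isField p.2
    ((mem_minimalPrimes_iff_ne_maximalIdeal hA.dim_eq_one).mp p.2)).isDomain
  exact _root_.rankAtStalk_eq_add_of_exact p.1 hf hfg hg

theorem rankAtStalk_quotient_self (p : MinimalPrime A) : rankAtStalk p.Quotient p.1 = 1 := by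
  obtain ⟨a, b, ha, hab, hb⟩ := hA.exists_isExactPair p.2
  have hadd := hA.rankAtStalk_eq_add_of_exact p (f := p.1.asIdeal.subtype)
    (g := p.1.asIdeal.mkQ) Subtype.val_injective
    (by rw [LinearMap.exact_iff, Submodule.range_subtype, Submodule.ker_mkQ])
    p.1.asIdeal.mkQ_surjective
  have hzero : rankAtStalk p.1.asIdeal p.1 = 0 :=
    rankAtStalk_eq_zero_of_smul_eq_zero p.1 hb fun m => Subtype.ext
      ((hab.mul_eq_zero_iff' m).mpr (Ideal.mem_span_singleton.mp (ha ▸ m.2)))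
  rw [hzero, zero_add, rankAtStalk_self, Pi.one_apply] at hadd
  exact hadd.symm

theorem rankAtStalk_quotient [DecidableEq (MinimalPrime A)] (p q : MinimalPrime A) :
    rankAtStalk p.Quotient q.1 = if p = q then 1 else 0 := by
  split_ifs with h
  · rw [h, hA.rankAtStalk_quotient_self]
  · exact rankAtStalk_quotient_eq_zero q.1 (mt MinimalPrime.eq_of_le h)

end Rank

variable [IsNoetherianRing A] (hA : IsPeriodicCurve A)
include hA

theorem hochsterTheta_succ (e : ℕ) (M N : Type u) [AddCommGroup M] [Module A M]
    [Module.Finite A M] [AddCommGroup N] [Module A N] [Module.Finite A N] :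
    hochsterTheta A (e + 1) M N = hochsterTheta A 1 M N :=
  (hA.hasFinitePeriodicTor M N).hochsterTheta_succ e

theorem hochsterTheta_eq_add_of_exact {M M' M'' : Type u} [AddCommGroup M] [Module A M]
    [Module.Finite A M] [AddCommGroup M'] [Module A M'] [Module.Finite A M'] [AddCommGroup M'']
    [Module A M''] [Module.Finite A M''] {f : M' →ₗ[A] M} {g : M →ₗ[A] M''}
    (hf : Function.Injective f) (hfg : Function.Exact f g) (hg : Function.Surjective g)
    (N : Type u) [AddCommGroup N] [Module A N] [Module.Finite A N] :
    hochsterTheta A 1 M N = hochsterTheta A 1 M' N + hochsterTheta A 1 M'' N :=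
  (hA.hasFinitePeriodicTor M' N).hochsterTheta_eq_add_of_exact (hA.hasFinitePeriodicTor M N)
    (hA.hasFinitePeriodicTor M'' N) hf hfg hg

theorem hochsterTheta_quotient_pos {p q : MinimalPrime A} (hpq : p ≠ q) :
    0 < hochsterTheta A 1 p.Quotient q.Quotient := by
  have hfin := hA.length_tor_ne_top 1 p.Quotient q.Quotient
  obtain ⟨⟨⟨p, hp⟩, hpmin⟩, ⟨⟨q, hq⟩, hqmin⟩⟩ := p, q
  obtain ⟨a, b, rfl, hab, -⟩ := hA.exists_isExactPair hpmin
  have haq : a ∉ q := fun h =>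
    hpq (MinimalPrime.eq_of_le ((Ideal.span_singleton_le_iff_mem q).mpr h))
  have hbq : b ∈ q := (hq.mem_or_mem
    ((hab.mul_eq_zero_iff b).mpr dvd_rfl ▸ q.zero_mem : a * b ∈ q)).resolve_left haq
  have ham : a ∈ maximalIdeal A :=
    le_maximalIdeal hp.ne_top (Ideal.mem_span_singleton_self a)
  have hreg : IsSMulRegular (A ⧸ q) a := by
    rw [isSMulRegular_iff_right_eq_zero_of_smul]
    refine Ideal.Quotient.mk_surjective.forall.mpr fun y hy => ?_
    have hay : a * y ∈ q := Ideal.Quotient.eq_zero_iff_mem.mp hy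
    exact Ideal.Quotient.eq_zero_iff_mem.mpr ((hq.mem_or_mem hay).resolve_left haq)
  rw [hab.hochsterTheta_succ]
  exact hab.hochsterTheta_zero_pos (hab.subsingleton_tor_one hreg)
    (hab.symm.nontrivial_tor_one hq.ne_top hbq ham) hfin

theorem hochsterTheta_eq_length_mul {T : Type u} [AddCommGroup T] [Module A T]
    (hT : IsFiniteLength A T) (N : Type u) [AddCommGroup N] [Module A N] [Module.Finite A N] :
    hochsterTheta A 1 T N =
      (Module.length A T).toNat * hochsterTheta A 1 (A ⧸ maximalIdeal A) N := by
  induction hT with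
  | of_subsingleton =>
    rw [hochsterTheta_eq_zero_of_flat, Module.length_eq_zero, ENat.toNat_zero, Nat.cast_zero,
      zero_mul]
  | @of_simple_quotient T _ _ K hsimple hK ih =>
    obtain ⟨I, hI, ⟨e⟩⟩ := isSimpleModule_iff_quot_maximal.mp hsimple
    obtain rfl := eq_maximalIdeal hI
    have := (isFiniteLength_iff_isNoetherian_isArtinian.mp hK.of_simple_quotient).1
    have hexact : Function.Exact K.subtype K.mkQ := by
      rw [LinearMap.exact_iff, Submodule.range_subtype, Submodule.ker_mkQ]
    rw [hA.hochsterTheta_eq_add_of_exact K.subtype_injective hexact K.mkQ_surjective, ih,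
      Module.length_eq_add_of_exact K.subtype K.mkQ K.subtype_injective K.mkQ_surjective hexact,
      Module.length_eq_one A (T ⧸ K), ENat.toNat_add (Module.length_ne_top_iff.mpr hK)
      ENat.one_ne_top, hochsterTheta_congr e, ENat.toNat_one, Nat.cast_add, Nat.cast_one, add_mul,
      one_mul]

theorem hochsterTheta_residueField (N : Type u) [AddCommGroup N] [Module A N]
    [Module.Finite A N] : hochsterTheta A 1 (A ⧸ maximalIdeal A) N = 0 := by
  obtain ⟨x, hx, hreg⟩ := hA.exists_regular
  have hf : Function.Injective (LinearMap.toSpanSingleton A A x) := fun y z hyz =>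
    hreg (by simpa only [LinearMap.toSpanSingleton_apply, smul_eq_mul, mul_comm] using hyz)
  have hfg : Function.Exact (LinearMap.toSpanSingleton A A x) (Ideal.span {x}).mkQ := by
    rw [LinearMap.exact_iff, Submodule.ker_mkQ, LinearMap.range_toSpanSingleton]
  have htheta : hochsterTheta A 1 (A ⧸ Ideal.span {x}) N = 0 := by
    have := hA.hochsterTheta_eq_add_of_exact hf hfg (Ideal.span {x}).mkQ_surjective N
    rwa [hochsterTheta_eq_zero_of_flat, zero_add, eq_comm] at this
  have hfinite : Module.length A (A ⧸ Ideal.span {x}) ≠ ⊤ :=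
    length_ne_top_of_forall_smul_eq_zero hA.dim_eq_one (J := Ideal.span {x})
      (fun p hp hle => notMem_nonZeroDivisors_of_mem_mem_minimalPrimes
        (hle (Ideal.mem_span_singleton_self x)) hp (mem_nonZeroDivisors_iff_left.mpr
          fun _ => hreg.right_eq_zero_of_smul))
      fun r hr => smul_quotient_eq_zero hr
  have hpos : Module.length A (A ⧸ Ideal.span {x}) ≠ 0 := by
    rwa [Ne, Module.length_eq_zero_iff, Submodule.Quotient.subsingleton_iff,
      Ideal.span_singleton_eq_top]
  rw [hA.hochsterTheta_eq_length_mul (Module.length_ne_top_iff.mp hfinite)] at htheta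
  exact (mul_eq_zero.mp htheta).resolve_left fun h =>
    ((ENat.toNat_eq_zero.mp (Nat.cast_eq_zero.mp h)).elim hpos hfinite)

theorem hochsterTheta_eq_sum (M N : Type u) [AddCommGroup M] [Module A M]
    [hM : Module.Finite A M] [AddCommGroup N] [Module A N] [Module.Finite A N] :
    hochsterTheta A 1 M N =
      ∑ p : MinimalPrime A, rankAtStalk M p.1 * hochsterTheta A 1 p.Quotient N := by
  classical
  induction hM using IsNoetherianRing.induction_on_isQuotientEquivQuotientPrime A with
  | subsingleton M => simp [hochsterTheta_eq_zero_of_flat]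
  | quotient M p e =>
    rw [hochsterTheta_congr e, rankAtStalk_eq_of_equiv e]
    by_cases hpm : p.asIdeal = maximalIdeal A
    · have hrank (q : MinimalPrime A) : rankAtStalk (A ⧸ p.asIdeal) q.1 = 0 :=
        rankAtStalk_quotient_eq_zero q.1 (hpm ▸ hA.not_maximalIdeal_le q)
      simp only [hrank, Nat.cast_zero, zero_mul, Finset.sum_const_zero]
      rw [hpm, hA.hochsterTheta_residueField]
    · lift p to MinimalPrime A using (mem_minimalPrimes_iff_ne_maximalIdeal hA.dim_eq_one).mpr hpm
      simp [hA.rankAtStalk_quotient p]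
  | exact M₁ M₂ M₃ f g hf hg hfg h₁ h₃ =>
    simp only [hA.hochsterTheta_eq_add_of_exact hf hfg hg, h₁, h₃,
      hA.rankAtStalk_eq_add_of_exact _ hf hfg hg, Nat.cast_add, add_mul, Finset.sum_add_distrib]

theorem hochsterTheta_eq_sum_sum (M N : Type u) [AddCommGroup M] [Module A M] [Module.Finite A M]
    [AddCommGroup N] [Module A N] [Module.Finite A N] :
    hochsterTheta A 1 M N = ∑ p : MinimalPrime A, ∑ q : MinimalPrime A,
      hochsterTheta A 1 p.Quotient q.Quotient * (rankAtStalk M p.1 * rankAtStalk N q.1) := by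
  rw [hA.hochsterTheta_eq_sum M N]
  refine Finset.sum_congr rfl fun p _ => ?_
  rw [hochsterTheta_comm, hA.hochsterTheta_eq_sum N, Finset.mul_sum]
  exact Finset.sum_congr rfl fun q _ => by rw [hochsterTheta_comm]; ring

theorem sum_hochsterTheta_quotient (M : Type u) [AddCommGroup M] [Module A M]
    [Module.Finite A M] : ∑ p : MinimalPrime A, hochsterTheta A 1 M p.Quotient = 0 := by
  have h := hA.hochsterTheta_eq_sum A M
  simp only [hochsterTheta_eq_zero_of_flat, rankAtStalk_self, Pi.one_apply, Nat.cast_one,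
    one_mul] at h
  exact (Finset.sum_congr rfl fun p _ => hochsterTheta_comm 1 M p.Quotient).trans h.symm

theorem neg_two_mul_hochsterTheta (M N : Type u) [AddCommGroup M] [Module A M]
    [Module.Finite A M] [AddCommGroup N] [Module A N] [Module.Finite A N] :
    -2 * hochsterTheta A 1 M N = ∑ p : MinimalPrime A, ∑ q : MinimalPrime A,
      hochsterTheta A 1 p.Quotient q.Quotient *
        ((rankAtStalk M p.1 - rankAtStalk M q.1) * (rankAtStalk N p.1 - rankAtStalk N q.1)) := by
  rw [hA.hochsterTheta_eq_sum_sum]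
  exact neg_two_mul_sum_mul_mul
    (w := fun p q : MinimalPrime A => hochsterTheta A 1 p.Quotient q.Quotient)
    (fun p q => hochsterTheta_comm 1 p.Quotient q.Quotient)
    (fun p => hA.sum_hochsterTheta_quotient p.Quotient)
    (fun p => (rankAtStalk M p.1 : ℤ)) fun p => (rankAtStalk N p.1 : ℤ)

theorem hochsterTheta_self_nonpos (M : Type u) [AddCommGroup M] [Module A M]
    [Module.Finite A M] : hochsterTheta A 1 M M ≤ 0 := by
  have h := sum_mul_sub_mul_sub_self_nonneg
    (fun p q : MinimalPrime A => hA.hochsterTheta_quotient_pos (p := p) (q := q))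
    fun p => (rankAtStalk M p.1 : ℤ)
  rw [← hA.neg_two_mul_hochsterTheta] at h
  linarith

theorem hochsterTheta_self_eq_zero_iff (M : Type u) [AddCommGroup M] [Module A M]
    [Module.Finite A M] : hochsterTheta A 1 M M = 0 ↔ HasConstantMinimalRank A M := by
  have h := sum_mul_sub_mul_sub_self_eq_zero_iff
    (fun p q : MinimalPrime A => hA.hochsterTheta_quotient_pos (p := p) (q := q))
    fun p => (rankAtStalk M p.1 : ℤ)
  rw [← hA.neg_two_mul_hochsterTheta, mul_eq_zero, or_iff_right (by norm_num : (-2 : ℤ) ≠ 0)] at h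
  simp only [h, Nat.cast_inj]
  exact ⟨fun h p q hp hq => h ⟨p, hp⟩ ⟨q, hq⟩, fun h p q => h p.1 q.1 p.2 q.2⟩

end IsPeriodicCurve

end RankFormula

section ThetaForm

open Module

variable {A : Type u} [CommRing A]

/-- The class of `M` in the reduced Grothendieck group. -/
def ReducedG0.cls (M : Type u) [AddCommGroup M] [Module A M] [Module.Finite A M] : ReducedG0 A :=
  QuotientAddGroup.mk (G0.cls A M)

theorem ReducedG0.hom_ext {G : Type*} [AddCommGroup G] {φ ψ : ReducedG0 A →+ G}
    (h : ∀ (M : Type u) [AddCommGroup M] [Module A M] [Module.Finite A M],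
      φ (ReducedG0.cls M) = ψ (ReducedG0.cls M)) : φ = ψ :=
  QuotientAddGroup.addMonoidHom_ext _ <| QuotientAddGroup.addMonoidHom_ext _ <|
    FreeAbelianGroup.lift_ext _ _ fun M => h M

/-- The homomorphism out of the reduced Grothendieck group induced by a function that is additive
on short exact sequences and vanishes on `A`. -/
def ReducedG0.lift {G : Type*} [AddCommGroup G] (φ : FGModuleCat.{u} A → G)
    (hadd : ∀ (M' M M'' : FGModuleCat.{u} A) (f : M' →ₗ[A] M) (g : M →ₗ[A] M''),
      Function.Injective f → Function.Exact f g → Function.Surjective g → φ M = φ M' + φ M'')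
    (hA : φ (FGModuleCat.of A A) = 0) : ReducedG0 A →+ G :=
  QuotientAddGroup.lift _
    (QuotientAddGroup.lift (G0Relations A) (FreeAbelianGroup.lift φ) <| by
      rw [G0Relations, AddSubgroup.closure_le]
      rintro _ ⟨M', M, M'', f, g, hf, hfg, hg, rfl⟩
      rw [SetLike.mem_coe, AddMonoidHom.mem_ker]
      simp only [map_sub, FreeAbelianGroup.lift_apply_of, hadd M' M M'' f g hf hfg hg]
      abel)
    (by
      rw [AddSubgroup.zmultiples_le, AddMonoidHom.mem_ker]
      exact (FreeAbelianGroup.lift_apply_of φ _).trans hA)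

theorem ReducedG0.lift_cls {G : Type*} [AddCommGroup G] (φ : FGModuleCat.{u} A → G) (hadd hA)
    (M : Type u) [AddCommGroup M] [Module A M] [Module.Finite A M] :
    ReducedG0.lift φ hadd hA (ReducedG0.cls M) = φ (FGModuleCat.of A M) :=
  FreeAbelianGroup.lift_apply_of φ _

namespace IsPeriodicCurve

variable [IsLocalRing A]

/-- The difference of the ranks at two minimal primes, which unlike the ranks themselves vanishes
on `A` and so is defined on the reduced Grothendieck group. -/
noncomputable def rankSub (hA : IsPeriodicCurve A) (p q : MinimalPrime A) :
    ReducedG0 A →+ ℚ :=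
  ReducedG0.lift (fun M => rankAtStalk M p.1 - rankAtStalk M q.1)
    (fun _ _ _ _ _ hf hfg hg => by
      rw [hA.rankAtStalk_eq_add_of_exact p hf hfg hg, hA.rankAtStalk_eq_add_of_exact q hf hfg hg]
      push_cast
      ring)
    (by simp)

theorem rankSub_cls (hA : IsPeriodicCurve A) (p q : MinimalPrime A) (M : Type u) [AddCommGroup M]
    [Module A M] [Module.Finite A M] :
    hA.rankSub p q (ReducedG0.cls M) = rankAtStalk M p.1 - rankAtStalk M q.1 :=
  ReducedG0.lift_cls ..

theorem rankSub_self (hA : IsPeriodicCurve A) (p : MinimalPrime A) : hA.rankSub p p = 0 :=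
  ReducedG0.hom_ext fun M => (hA.rankSub_cls p p M).trans (sub_self _)

/-- The extension of `rankSub` to rational coefficients. -/
noncomputable def rationalRankSub (hA : IsPeriodicCurve A) (p q : MinimalPrime A) :
    RationalReducedG0 A →ₗ[ℚ] ℚ :=
  LinearMap.liftBaseChange ℚ (hA.rankSub p q).toIntLinearMap

theorem rationalRankSub_cls (hA : IsPeriodicCurve A) (p q : MinimalPrime A) (M : Type u)
    [AddCommGroup M] [Module A M] [Module.Finite A M] :
    hA.rationalRankSub p q (RationalReducedG0.cls A M) =
      rankAtStalk M p.1 - rankAtStalk M q.1 := by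
  rw [← hA.rankSub_cls]
  exact (LinearMap.liftBaseChange_tmul ..).trans (one_smul ..)

theorem rationalRankSub_self (hA : IsPeriodicCurve A) (p : MinimalPrime A) :
    hA.rationalRankSub p p = 0 := by
  rw [rationalRankSub, rankSub_self]
  exact (LinearMap.liftBaseChangeEquiv ℚ).map_zero

variable [IsNoetherianRing A]

/-- The form induced by Hochster's theta invariant on the rational reduced Grothendieck group,
written in terms of rank differences as in `neg_two_mul_hochsterTheta`. -/
noncomputable def thetaForm (hA : IsPeriodicCurve A) :
    LinearMap.BilinForm ℚ (RationalReducedG0 A) :=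
  -((1 / 2 : ℚ) • ∑ p : MinimalPrime A, ∑ q : MinimalPrime A,
    (hochsterTheta A 1 p.Quotient q.Quotient : ℚ) •
      LinearMap.BilinForm.linMulLin (hA.rationalRankSub p q) (hA.rationalRankSub p q))

variable (hA : IsPeriodicCurve A)

theorem neg_thetaForm_apply (x y : RationalReducedG0 A) :
    (-hA.thetaForm) x y = 1 / 2 * ∑ p : MinimalPrime A, ∑ q : MinimalPrime A,
      (hochsterTheta A 1 p.Quotient q.Quotient : ℚ) *
        (hA.rationalRankSub p q x * hA.rationalRankSub p q y) := by
  simp only [thetaForm, neg_neg, LinearMap.smul_apply, LinearMap.sum_apply,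
    LinearMap.BilinForm.linMulLin_apply, smul_eq_mul]

theorem thetaForm_cls (M N : Type u) [AddCommGroup M] [Module A M] [Module.Finite A M]
    [AddCommGroup N] [Module A N] [Module.Finite A N] :
    hA.thetaForm (RationalReducedG0.cls A M) (RationalReducedG0.cls A N) =
      (hochsterTheta A 1 M N : ℚ) := by
  have hform := hA.neg_thetaForm_apply (RationalReducedG0.cls A M) (RationalReducedG0.cls A N)
  have htheta := congrArg (Int.cast : ℤ → ℚ) (hA.neg_two_mul_hochsterTheta M N)
  push_cast at htheta
  simp only [rationalRankSub_cls, ← htheta, LinearMap.neg_apply] at hform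
  linarith

theorem isPosSemidef_neg_thetaForm : (-hA.thetaForm).IsPosSemidef := by
  refine LinearMap.BilinForm.isPosSemidef_def.mpr ⟨⟨fun x y => ?_⟩, ⟨fun x => ?_⟩⟩
  · simp only [neg_thetaForm_apply, mul_comm (hA.rationalRankSub _ _ x)]
  · rw [neg_thetaForm_apply]
    refine mul_nonneg (by norm_num) (Finset.sum_nonneg fun p _ => Finset.sum_nonneg fun q _ => ?_)
    obtain rfl | hpq := eq_or_ne p q
    · rw [rationalRankSub_self, LinearMap.zero_apply, zero_mul, mul_zero]
    · exact mul_nonneg (by exact_mod_cast (hA.hochsterTheta_quotient_pos hpq).le)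
        (mul_self_nonneg _)

end IsPeriodicCurve

end ThetaForm

theorem mainTheorem10 (A : Type u) [CommRing A] [IsLocalRing A]
    (hA : IsLocalHypersurface A) (hsing : HasIsolatedSingularity A)
    (hdim : ringKrullDim A = 1) :
    -- the lengths in the definition of `θ^A` are finite
    (∀ (M : Type u) [AddCommGroup M] [Module A M] [Module.Finite A M]
        (N : Type u) [AddCommGroup N] [Module A N] [Module.Finite A N] (i : ℕ),
        ringKrullDim A < (i : WithBot ℕ∞) → Module.length A (torModule A i M N) ≠ ⊤) ∧
    -- `θ^A` does not depend on `e`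
    (∀ (M : Type u) [AddCommGroup M] [Module A M] [Module.Finite A M]
        (N : Type u) [AddCommGroup N] [Module A N] [Module.Finite A N] (e e' : ℕ),
        ringKrullDim A ≤ ((2 * e : ℕ) : WithBot ℕ∞) →
        ringKrullDim A ≤ ((2 * e' : ℕ) : WithBot ℕ∞) →
        hochsterTheta A e M N = hochsterTheta A e' M N) ∧
    ∀ e : ℕ, ringKrullDim A ≤ ((2 * e : ℕ) : WithBot ℕ∞) →
      (∀ (M : Type u) [AddCommGroup M] [Module A M] [Module.Finite A M],
        hochsterTheta A e M M ≤ 0 ∧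
        (hochsterTheta A e M M = 0 ↔ HasConstantMinimalRank A M)) ∧
      -- `θ^A` induces a symmetric negative semidefinite form on the rational reduced group
      ∃ B : LinearMap.BilinForm ℚ (RationalReducedG0 A),
        (∀ (M : Type u) [AddCommGroup M] [Module A M] [Module.Finite A M]
            (N : Type u) [AddCommGroup N] [Module A N] [Module.Finite A N],
            B (RationalReducedG0.cls A M) (RationalReducedG0.cls A N) =
              (hochsterTheta A e M N : ℚ)) ∧
        (-B).IsPosSemidef := by
  have := hA.1
  have hcurve := hA.isPeriodicCurve hsing hdim
  have theta_eq (e : ℕ) (he : ringKrullDim A ≤ ((2 * e : ℕ) : WithBot ℕ∞)) (M N : Type u)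
      [AddCommGroup M] [Module A M] [Module.Finite A M]
      [AddCommGroup N] [Module A N] [Module.Finite A N] :
      hochsterTheta A e M N = hochsterTheta A 1 M N := by
    obtain _ | e := e
    · rw [hdim] at he
      norm_num at he
    · exact hcurve.hochsterTheta_succ e M N
  refine ⟨fun M _ _ _ N _ _ _ i hi => ?_, fun M _ _ _ N _ _ _ e e' he he' => ?_,
    fun e he => ⟨fun M _ _ _ => ?_, hcurve.thetaForm, fun M _ _ _ N _ _ _ => ?_,
      hcurve.isPosSemidef_neg_thetaForm⟩⟩
  · obtain _ | i := i
    · rw [hdim] at hi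
      norm_num at hi
    · exact hcurve.length_tor_ne_top i M N
  · rw [theta_eq e he, theta_eq e' he']
  · rw [theta_eq e he]
    exact ⟨hcurve.hochsterTheta_self_nonpos M, hcurve.hochsterTheta_self_eq_zero_iff M⟩
  · rw [theta_eq e he, hcurve.thetaForm_cls]
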